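/- Let $P=\{p_\ell\}$ and $Q=\{q_\ell\}$ be two sets of $n\ge 1$ points of the plane in convex position (every point is a vertex of the convex hull of its set), both labelled by $\{0,1,\dots,n-1\}$. Each comes with its convex hull, given as the cyclic counterclockwise list of labels along the hull boundary. For a set $S$ of labels, a pair of *compatible paths* on the points of $P$ and $Q$ with labels in $S$ is a sequence $\tau$ listing each label of $S$ exactly once, such that the straight-line path through the points $p_{\tau_1},p_{\tau_2},\dots$ and the one through $q_{\tau_1},q_{\tau_2},\dots$ are both noncrossing (two edges of a path meet only if they are successive, and then only in their common endpoint); $\tau_1$ is its initial label. An *interval* on $P$ (or $Q$) is a sequence of distinct labels that appear consecutively along the hull boundary, clockwise or counterclockwise. Given a label $x$, let $\sigma_x$ be any sequence obtained as follows. Start with the sequence $(x)$. As long as possible, let $\{a,b\}$ be the labels outside the current sequence just before and just after the interval formed by its labels on $P$, and let $\{c,d\}$ be the analogous labels on $Q$; append the labels in $\{a,b\}\cap\{c,d\}$, in arbitrary order if there are two. Stop when there is no common label. **Theorem.** (1) There are a constant $C$ and a program for a unit-cost random access machine (with instructions for constants, copying, addition, truncated subtraction, indirect load and store, and comparisons of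 registers) which, for all $n\ge1$ and all such $P,Q$, given $n$ and the two hull lists, halts after at most $Cn$ steps, never writing a number larger than $Cn$, and either outputs the label sequence of a pair of compatible paths on $P$ and $Q$, or reports correctly that none exist. (2) For all such $P,Q$ and every label $x$, a sequence $\sigma_x$ exists, and for every such $\sigma_x$: (a) $P$ and $Q$ have compatible paths with initial label $x$ if and only if $\sigma_x$ has length $n$, and in that case $\sigma_x$ is itself the label sequence of compatible paths. (b) If $\sigma_x$ has length less than $n$, then no label in $\sigma_x$ is the initial label of compatible paths of $P$ and $Q$. (c) If $\sigma_x$ has length less than $n$ and $P$ and $Q$ have compatible paths, then the labels of $\sigma_x$ can be listed in an order that is an interval both on $P$ and on $Q$. (d) If $\sigma_x$ has length less than $n$ and $L$ is a listing of its labels that is an interval both on $P$ and on $Q$, let $P'$ and $Q'$ be obtained from $P$ and $Q$ by deleting the points whose labels are interior to $L$ (neither first nor last in $L$). Then for every remaining label $z$, $P$ and $Q$ have compatible paths with initial label $z$ if and only if $P'$ and $Q'$ have compatible paths with initial label $z$. -/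

import Mathlib

namespace ConvexPaths

/-! ### Labelled point sets and noncrossing paths -/

/-- The Euclidean plane. -/
abbrev Plane : Type := EuclideanSpace ℝ (Fin 2)

/-- Twice the signed area of the triangle `a b c`; it is positive iff `a, b, c` is a
counterclockwise (left) turn. -/
def orient (a b c : Plane) : ℝ :=
  (b 0 - a 0) * (c 1 - a 1) - (b 1 - a 1) * (c 0 - a 0)

/-- `h` lists the labels of the points `p` in counterclockwise order along the boundary of their
convex hull, starting anywhere (`h i` is the label at position `i`): the points
`p (h 0), p (h 1), …, p (h (n-1))` are the consecutive vertices of a strictly convex polygon that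
is traversed counterclockwise. For at most two points every listing qualifies. -/
def IsHullOrder {n : ℕ} (p : Fin n → Plane) (h : Equiv.Perm (Fin n)) : Prop :=
  ∀ i j k : Fin n, i < j → j < k → 0 < orient (p (h i)) (p (h j)) (p (h k))

/-- The straight-line path through the points labelled `τ[0], τ[1], …` is noncrossing: two of its
edges have no common point, except that two successive edges share their common end. -/
def IsNoncrossing {ι : Type*} (p : ι → Plane) (τ : List ι) : Prop :=
  ∀ (i j : ℕ) (hij : i < j) (hj : j + 1 < τ.length),
    segment ℝ (p τ[i]) (p τ[i + 1]) ∩ segment ℝ (p τ[j]) (p τ[j + 1]) ⊆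
      {x | j = i + 1 ∧ x = p τ[j]}

/-- `τ` is the label sequence of a pair of compatible paths on the two point sets that consist of
the points of `p`, respectively of `q`, with labels in `S`: it visits each label in `S`
exactly once, and it gives a noncrossing path in both point sets. -/
structure IsCompatible {ι : Type*} (p q : ι → Plane) (S : Set ι) (τ : List ι) : Prop where
  nodup : τ.Nodup
  mem_iff : ∀ y, y ∈ τ ↔ y ∈ S
  noncrossing_left : IsNoncrossing p τ
  noncrossing_right : IsNoncrossing q τ

/-- There are compatible paths with initial label `x`. -/
def HasCompatibleFrom {ι : Type*} (p q : ι → Plane) (S : Set ι) (x : ι) : Prop :=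
  ∃ τ : List ι, IsCompatible p q S τ ∧ τ.head? = some x

/-! ### Intervals and the greedy construction -/

/-- The label after `y` in the cyclic order `h`. -/
def next {n : ℕ} (h : Equiv.Perm (Fin n)) (y : Fin n) : Fin n :=
  h (finRotate n (h.symm y))

/-- An interval: a sequence of distinct labels that appear consecutively around the boundary,
counterclockwise or clockwise. -/
def IsInterval {n : ℕ} (h : Equiv.Perm (Fin n)) (L : List (Fin n)) : Prop :=
  L.Nodup ∧ (L.IsChain (fun y z => next h y = z) ∨ L.IsChain (fun y z => next h z = y))

/-- The labels just before and just after the set of labels in `l`, which in all uses is the set of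
labels of an interval: the labels outside `l` with a boundary neighbour in `l`. (There are two of
them, one if only one label is missing, and none if `l` contains all labels.) -/
def outerLabels {n : ℕ} (h : Equiv.Perm (Fin n)) (l : List (Fin n)) : Set (Fin n) :=
  {y | y ∉ l ∧ (next h y ∈ l ∨ ∃ z ∈ l, next h z = y)}

/-- The sequences produced by the greedy construction from `x`: start with `x`; in each step, if the
label set `{a, b}` just before and after the interval in the first hull and the corresponding set
`{c, d}` in the second hull have common labels, append the common labels (one or two of them, in
arbitrary order). -/
inductive GreedyStage {n : ℕ} (hP hQ : Equiv.Perm (Fin n)) (x : Fin n) : List (Fin n) → Prop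
  | start : GreedyStage hP hQ x [x]
  | step (l e : List (Fin n)) : GreedyStage hP hQ x l → e ≠ [] → e.Nodup →
      (∀ y, y ∈ e ↔ y ∈ outerLabels hP l ∩ outerLabels hQ l) → GreedyStage hP hQ x (l ++ e)

/-- `σ` is a sequence `σ_x`: it is produced by the greedy construction from `x`, and the
construction ends with it, since there are no common labels any more. -/
def IsGreedy {n : ℕ} (hP hQ : Equiv.Perm (Fin n)) (x : Fin n) (σ : List (Fin n)) : Prop :=
  GreedyStage hP hQ x σ ∧ outerLabels hP σ ∩ outerLabels hQ σ = ∅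

/-! ### A random access machine with unit costs and bounded words -/

/-- Contents of the registers and of the memory cells. A program mentions finitely many registers;
the memory is addressed indirectly. -/
structure State where
  reg : ℕ → ℕ
  mem : ℕ → ℕ

/-- The elementary instructions, in terms of register numbers `r`, `a`, `b`. -/
inductive Instr where
  /-- `r := c` -/
  | const (r c : ℕ)
  /-- `r := a` -/
  | copy (r a : ℕ)
  /-- `r := a + b` -/
  | add (r a b : ℕ)
  /-- `r := a - b`, or `0` if `a < b` -/
  | sub (r a b : ℕ)
  /-- `r := memory[a]` -/
  | load (r a : ℕ)
  /-- `memory[a] := b` -/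
  | store (a b : ℕ)

/-- The word that an instruction computes and writes. -/
def Instr.value (s : State) : Instr → ℕ
  | .const _ c => c
  | .copy _ a => s.reg a
  | .add _ a b => s.reg a + s.reg b
  | .sub _ a b => s.reg a - s.reg b
  | .load _ a => s.mem (s.reg a)
  | .store _ b => s.reg b

/-- The state after an instruction. -/
def Instr.result (s : State) : Instr → State
  | .const r c => { s with reg := Function.update s.reg r c }
  | .copy r a => { s with reg := Function.update s.reg r (s.reg a) }
  | .add r a b => { s with reg := Function.update s.reg r (s.reg a + s.reg b) }
  | .sub r a b => { s with reg := Function.update s.reg r (s.reg a - s.reg b) }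
  | .load r a => { s with reg := Function.update s.reg r (s.mem (s.reg a)) }
  | .store a b => { s with mem := Function.update s.mem (s.reg a) (s.reg b) }

/-- The tests: comparisons of two registers. -/
inductive Test where
  | lt (a b : ℕ)
  | eq (a b : ℕ)

/-- The test succeeds. -/
def Test.Holds (s : State) : Test → Prop
  | .lt a b => s.reg a < s.reg b
  | .eq a b => s.reg a = s.reg b

/-- Programs with structured control flow. -/
inductive Prog where
  | skip
  | instr (i : Instr)
  | seq (c d : Prog)
  | ite (b : Test) (c d : Prog)
  | loop (b : Test) (c : Prog)

/-- `Runs W c s t s'`: the program `c`, started in state `s`, halts in state `s'` after exactly `t`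
steps, and no word that it writes exceeds `W`. Each instruction and each test is one step; a program
that writes a larger word has no run. `loop b c` is "while `b` do `c`". -/
inductive Runs (W : ℕ) : Prog → State → ℕ → State → Prop
  | skip (s : State) : Runs W .skip s 1 s
  | instr (i : Instr) (s : State) : i.value s ≤ W → Runs W (.instr i) s 1 (i.result s)
  | seq (c d : Prog) (s s₁ s₂ : State) (t₁ t₂ : ℕ) :
      Runs W c s t₁ s₁ → Runs W d s₁ t₂ s₂ → Runs W (.seq c d) s (t₁ + t₂) s₂
  | ite_true (b : Test) (c d : Prog) (s s₁ : State) (t : ℕ) :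
      b.Holds s → Runs W c s t s₁ → Runs W (.ite b c d) s (t + 1) s₁
  | ite_false (b : Test) (c d : Prog) (s s₁ : State) (t : ℕ) :
      ¬ b.Holds s → Runs W d s t s₁ → Runs W (.ite b c d) s (t + 1) s₁
  | loop_true (b : Test) (c : Prog) (s s₁ s₂ : State) (t₁ t₂ : ℕ) :
      b.Holds s → Runs W c s t₁ s₁ → Runs W (.loop b c) s₁ t₂ s₂ →
      Runs W (.loop b c) s (t₁ + t₂ + 1) s₂
  | loop_false (b : Test) (c : Prog) (s : State) :
      ¬ b.Holds s → Runs W (.loop b c) s 1 s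

/-- The input: register `0` holds `n`, memory cells `0, …, n-1` hold the first hull order, cells
`n, …, 2n-1` hold the second one, and everything else is `0`. -/
def inputState {n : ℕ} (hP hQ : Equiv.Perm (Fin n)) : State where
  reg r := if r = 0 then n else 0
  mem a :=
    if ha : a < n then (hP ⟨a, ha⟩ : ℕ)
    else if hb : a - n < n then (hQ ⟨a - n, hb⟩ : ℕ)
    else 0

/-- The machine answers with the label sequence `τ`: register `0` holds `1`, and memory cells
`0, 1, …` hold `τ`. -/
def AnswersWith {n : ℕ} (s : State) (τ : List (Fin n)) : Prop :=
  s.reg 0 = 1 ∧ ∀ (i : ℕ) (hi : i < τ.length), s.mem i = (τ[i] : ℕ)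

/-- The machine answers that there is no solution: register `0` holds `0`. -/
def AnswersNone (s : State) : Prop := s.reg 0 = 0

end ConvexPaths

open ConvexPaths

/-! In convex position only the cyclic order of the labels matters: chords without a common end meet
exactly when their ends alternate along the hull. A path is noncrossing iff no chord spanned by a
prefix crosses a chord spanned by the remaining suffix (`isNoncrossing_iff_separated`). For a path
through all labels this means that every prefix occupies an arc of the hull: each label after the
first is a hull neighbour of an earlier one (`grows_iff_separated`). So compatible paths are the
sequences of all labels that grow on both hulls at once (`isCompatible_univ_iff`). The separation
criterion is symmetric in prefix and suffix, hence reversed paths grow too.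

A set is stuck if no label outside it neighbours it on both hulls. A sequence growing on both hulls
cannot leave a stuck set in which it starts (`Stuck.subset_of_grows`). The greedy result is either
everything or a proper stuck set `A`, in which no compatible path can start; this is (a) and (b). By
reversal none can end in `A` either. A compatible `τ` therefore begins and ends outside `A`, and
then labels that are successive among those of `A` along `τ` are neighbours on each hull
(`adj_of_consecutive`). Filtering `τ` by `A` yields the common interval of (c).

For (d), deleting points just filters a path. Conversely, take a path from `z` on the reduced sets
and a greedy sequence `B` from `z` on all labels. Being stuck, `B` contains a common interval or
misses it. If `B` were proper, the first label of the path outside `B` would still have neighbours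
among its predecessors on both hulls (`Separated.exists_adj_of_delete`), a contradiction.

The program deletes nothing. After a failed greedy run it restarts at the label following the
explored set on the first hull, until `n` labels have been counted. If compatible paths exist,
failed sets are common intervals, and two of them sharing a label coincide (`IsDeadEnd.subset`); so
no label is counted twice and `n` counted labels rule out every start. If none exist, labels may be
counted repeatedly, but then the negative answer is right anyway. In both cases the time is paid for
by the count, which is below `n` before each round and grows by at most `n` in it. -/

namespace ConvexPaths

/-! ### Cyclic order along the hull -/

/-- The position of a label in the listing `h`. -/
def pos {n : ℕ} (h : Equiv.Perm (Fin n)) (y : Fin n) : ℕ := (h.symm y : ℕ)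

theorem pos_inj {n : ℕ} {h : Equiv.Perm (Fin n)} {y z : Fin n} : pos h y = pos h z ↔ y = z := by
  simp [pos, Fin.val_inj]

theorem pos_lt {n : ℕ} (h : Equiv.Perm (Fin n)) (y : Fin n) : pos h y < n := (h.symm y).2

theorem pos_next {n : ℕ} (h : Equiv.Perm (Fin n)) (y : Fin n) :
    pos h (next h y) = if pos h y + 1 = n then 0 else pos h y + 1 := by
  cases n with
  | zero => exact y.elim0
  | succ n =>
    simp only [pos, next, Equiv.symm_apply_apply, coe_finRotate, Fin.ext_iff, Fin.val_last]
    simp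

/-- `a, b, c` are distinct and in counterclockwise order. -/
def Cyc {n : ℕ} (h : Equiv.Perm (Fin n)) (a b c : Fin n) : Prop :=
  (pos h a < pos h b ∧ pos h b < pos h c) ∨ (pos h b < pos h c ∧ pos h c < pos h a) ∨
    (pos h c < pos h a ∧ pos h a < pos h b)

/-- The chords `a c` and `b d` cross, with `a, b, c, d` in counterclockwise order. -/
def Alternate {n : ℕ} (h : Equiv.Perm (Fin n)) (a b c d : Fin n) : Prop :=
  Cyc h a b c ∧ Cyc h c d a

/-- No chord spanned by `X` crosses a chord spanned by `Y`. -/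
def Separated {n : ℕ} (h : Equiv.Perm (Fin n)) (X Y : List (Fin n)) : Prop :=
  ∀ a ∈ X, ∀ c ∈ X, ∀ b ∈ Y, ∀ d ∈ Y, ¬ Alternate h a b c d

theorem Separated.symm {n : ℕ} {h : Equiv.Perm (Fin n)} {X Y : List (Fin n)}
    (H : Separated h X Y) : Separated h Y X := by
  intro a ha c hc b hb d hd hA
  refine H b hb d hd c hc a ha ?_
  revert hA
  simp only [Alternate, Cyc]
  omega

theorem Separated.mono {n : ℕ} {h : Equiv.Perm (Fin n)} {X Y X' Y' : List (Fin n)}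
    (H : Separated h X Y) (hX : X' ⊆ X) (hY : Y' ⊆ Y) : Separated h X' Y' :=
  fun a ha c hc b hb d hd => H a (hX ha) c (hX hc) b (hY hb) d (hY hd)

theorem cyc_of_ne {n : ℕ} {h : Equiv.Perm (Fin n)} {a b c : Fin n} (hab : a ≠ b) (hbc : b ≠ c)
    (hac : a ≠ c) : Cyc h a b c ∨ Cyc h c b a := by
  rw [Ne, ← pos_inj (h := h)] at hab hbc hac
  simp only [Cyc]
  omega

theorem Cyc.rotate {n : ℕ} {h : Equiv.Perm (Fin n)} {a b c : Fin n} (hc : Cyc h a b c) :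
    Cyc h c a b := by
  simp only [Cyc] at hc ⊢
  omega

/-! ### Convex position -/

theorem orient_pos_of_cyc {n : ℕ} {p : Fin n → Plane} {h : Equiv.Perm (Fin n)}
    (H : IsHullOrder p h) {a b c : Fin n} (hc : Cyc h a b c) :
    0 < orient (p a) (p b) (p c) := by
  have key : ∀ a b c : Fin n, pos h a < pos h b → pos h b < pos h c →
      0 < orient (p a) (p b) (p c) := by
    intro a b c h1 h2
    simpa using H (h.symm a) (h.symm b) (h.symm c) h1 h2
  have rot : ∀ u v w : Plane, orient u v w = orient v w u := by
    intro u v w; simp only [orient]; ring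
  rcases hc with ⟨h1, h2⟩ | ⟨h1, h2⟩ | ⟨h1, h2⟩
  · exact key a b c h1 h2
  · rw [rot]; exact key b c a h1 h2
  · rw [rot, rot]; exact key c a b h1 h2

/-- `orient a b` is affine in its last argument, so its values on a segment are governed by those at
the ends. -/
theorem orient_of_mem_segment {a b c d x : Plane} (hx : x ∈ segment ℝ c d) :
    ∃ s t : ℝ, 0 ≤ s ∧ 0 ≤ t ∧ s + t = 1 ∧ x = s • c + t • d ∧
      orient a b x = s * orient a b c + t * orient a b d := by
  obtain ⟨s, t, hs, ht, hst, rfl⟩ := hx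
  refine ⟨s, t, hs, ht, hst, rfl, ?_⟩
  have : s = 1 - t := by linarith
  subst this
  simp only [orient, PiLp.add_apply, PiLp.smul_apply, smul_eq_mul]
  ring

theorem orient_left_self (a b : Plane) : orient a b a = 0 := by simp only [orient]; ring

theorem orient_right_self (a b : Plane) : orient a b b = 0 := by simp only [orient]; ring

/-- `orient a b` vanishes on the first segment and is positive on the second. -/
theorem disjoint_segments_of_orient_pos {a b c d : Plane} (hc : 0 < orient a b c)
    (hd : 0 < orient a b d) : Disjoint (segment ℝ a b) (segment ℝ c d) := by
  rw [Set.disjoint_left]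
  intro x hx hx'
  obtain ⟨s, t, hs, ht, hst, -, h1⟩ := orient_of_mem_segment (a := a) (b := b) hx
  obtain ⟨s', t', hs', ht', hst', -, h2⟩ := orient_of_mem_segment (a := a) (b := b) hx'
  rw [orient_left_self, orient_right_self] at h1
  have h3 : 0 < s' * orient a b c + t' * orient a b d := by
    rcases hs'.eq_or_lt with h0 | h0
    · have : t' = 1 := by linarith
      subst this
      rw [← h0]; linarith
    · have := mul_pos h0 hc
      have := mul_nonneg ht' hd.le
      linarith
  linarith

theorem segments_meet_of_orient {a b c d : Plane} (hb : 0 < orient a b c) (hd : 0 < orient c d a)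
    (hbc : 0 < orient b c d) (hda : 0 < orient d a b) :
    (segment ℝ a c ∩ segment ℝ b d).Nonempty := by
  -- the weights are the areas of the triangles cut off by the other diagonal
  set A := orient b c d with hA
  set B := orient d a b with hB
  set C := orient a b c with hC
  set D := orient c d a with hD
  have hsum : A + B = C + D := by simp only [hA, hB, hC, hD, orient]; ring
  have hpos : 0 < A + B := by linarith
  have e1 : A / (A + B) + B / (A + B) = 1 := by rw [← add_div]; exact div_self hpos.ne'
  have e2 : D / (A + B) + C / (A + B) = 1 := by
    rw [← add_div, div_eq_one_iff_eq hpos.ne']; linarith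
  refine ⟨(A / (A + B)) • a + (B / (A + B)) • c,
    ⟨_, _, by positivity, by positivity, e1, rfl⟩,
    ⟨D / (A + B), C / (A + B), by positivity, by positivity, e2, ?_⟩⟩
  ext i
  simp only [PiLp.add_apply, PiLp.smul_apply, smul_eq_mul]
  field_simp
  fin_cases i <;> simp only [hA, hB, hC, hD, orient] <;> simp <;> ring

theorem Alternate.segments_meet {n : ℕ} {p : Fin n → Plane} {h : Equiv.Perm (Fin n)}
    (H : IsHullOrder p h) {a b c d : Fin n} (hA : Alternate h a b c d) :
    (segment ℝ (p a) (p c) ∩ segment ℝ (p b) (p d)).Nonempty := by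
  refine segments_meet_of_orient (orient_pos_of_cyc H hA.1) (orient_pos_of_cyc H hA.2)
    (orient_pos_of_cyc H ?_) (orient_pos_of_cyc H ?_) <;>
  · revert hA
    simp only [Alternate, Cyc]
    omega

/-- Without alternation `b` and `d` lie on the same arc between `a` and `c`, hence strictly on one
side of the line through `p a` and `p c`. -/
theorem disjoint_segments_of_not_alternate {n : ℕ} {p : Fin n → Plane} {h : Equiv.Perm (Fin n)}
    (H : IsHullOrder p h) {a b c d : Fin n} (hac : a ≠ c) (hab : a ≠ b) (had : a ≠ d) (hcb : c ≠ b)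
    (hcd : c ≠ d) (h1 : ¬ Alternate h a b c d) (h2 : ¬ Alternate h a d c b) :
    Disjoint (segment ℝ (p a) (p c)) (segment ℝ (p b) (p d)) := by
  rcases cyc_of_ne (h := h) hab hcb.symm hac with hb | hb
  · have hd : Cyc h a d c := (cyc_of_ne (h := h) had hcd.symm hac).resolve_right fun hd => h1 ⟨hb, hd⟩
    rw [segment_symm]
    exact disjoint_segments_of_orient_pos (orient_pos_of_cyc H hb.rotate)
      (orient_pos_of_cyc H hd.rotate)
  · have hd : Cyc h c d a := (cyc_of_ne (h := h) had hcd.symm hac).resolve_left fun hd => h2 ⟨hd, hb⟩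
    exact disjoint_segments_of_orient_pos (orient_pos_of_cyc H hb.rotate)
      (orient_pos_of_cyc H hd.rotate)

theorem orient_ne_zero_of_ne {n : ℕ} {p : Fin n → Plane} {h : Equiv.Perm (Fin n)}
    (H : IsHullOrder p h) {a b c : Fin n} (hab : a ≠ b) (hbc : b ≠ c) (hac : a ≠ c) :
    orient (p a) (p b) (p c) ≠ 0 := by
  rcases cyc_of_ne (h := h) hab hbc hac with hc | hc
  · exact (orient_pos_of_cyc H hc).ne'
  · have := orient_pos_of_cyc H hc
    have e : orient (p a) (p b) (p c) = - orient (p c) (p b) (p a) := by simp only [orient]; ring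
    rw [e]
    exact neg_ne_zero.2 this.ne'

theorem segments_inter_subset_of_orient_ne_zero {a b c : Plane} (hne : orient a b c ≠ 0) :
    segment ℝ a b ∩ segment ℝ b c ⊆ {b} := by
  rintro x ⟨hx, hx'⟩
  obtain ⟨s, t, hs, ht, hst, -, h1⟩ := orient_of_mem_segment (a := a) (b := b) hx
  obtain ⟨s', t', hs', ht', hst', hxe, h2⟩ := orient_of_mem_segment (a := a) (b := b) hx'
  rw [orient_left_self, orient_right_self] at h1
  rw [orient_right_self, h1] at h2
  have ht0 : t' = 0 := by
    have : t' * orient a b c = 0 := by linarith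
    exact (mul_eq_zero.1 this).resolve_right hne
  have hs1 : s' = 1 := by linarith
  rw [hxe, ht0, hs1]
  simp

/-! ### Noncrossing paths and separated prefixes -/

/-- A property that holds somewhere and fails somewhere in a list changes between two successive
elements. -/
theorem exists_succ_change {α : Type*} (S : α → Prop) :
    ∀ (l : List α) (a c : α), a ∈ l → c ∈ l → S a → ¬ S c →
      ∃ (i : ℕ) (hi : i + 1 < l.length), ¬ (S l[i] ↔ S l[i + 1])
  | [], a, _, ha, _, _, _ => by simp at ha
  | [y], a, c, ha, hc, hSa, hSc => by
    simp only [List.mem_singleton] at ha hc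
    subst ha hc
    exact absurd hSa hSc
  | y :: z :: l, a, c, ha, hc, hSa, hSc => by
    by_cases hyz : S y ↔ S z
    · have aux : ∀ w ∈ y :: z :: l, ∃ w' ∈ z :: l, (S w' ↔ S w) := by
        intro w hw
        rcases List.mem_cons.1 hw with rfl | hw
        · exact ⟨z, by simp, hyz.symm⟩
        · exact ⟨w, hw, Iff.rfl⟩
      obtain ⟨a', ha', hSa'⟩ := aux a ha
      obtain ⟨c', hc', hSc'⟩ := aux c hc
      obtain ⟨i, hi, hch⟩ := exists_succ_change S (z :: l) a' c' ha' hc' (hSa'.2 hSa)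
        (fun hh => hSc (hSc'.1 hh))
      exact ⟨i + 1, by simpa using hi, by simpa using hch⟩
    · exact ⟨0, by simp, by simpa using hyz⟩

/-- A crossing of two spanned chords forces a crossing of two path edges, by changing sides twice:
some prefix edge separates the ends of the suffix chord, and then some suffix edge separates the
ends of that prefix edge. Conversely, two edges that are not successive are spanned by a prefix and
its suffix, and successive edges meet only in their common end because no three points are
collinear. -/
theorem isNoncrossing_iff_separated {n : ℕ} {p : Fin n → Plane} {h : Equiv.Perm (Fin n)}
    (H : IsHullOrder p h) {τ : List (Fin n)} (hτ : τ.Nodup) :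
    IsNoncrossing p τ ↔ ∀ l₁ l₂, τ = l₁ ++ l₂ → Separated h l₁ l₂ := by
  constructor
  · rintro hN X Y rfl a ha c hc b hb d hd hA
    have hdis : ∀ u ∈ X, ∀ v ∈ Y, pos h u ≠ pos h v := by
      intro u hu v hv huv
      exact (List.nodup_append.1 hτ).2.2 u hu v hv (pos_inj.1 huv)
    obtain ⟨i, hi, hch⟩ := exists_succ_change (fun u => Cyc h b u d) X c a hc ha
      (by revert hA; simp only [Alternate, Cyc]; omega)
      (by revert hA; simp only [Alternate, Cyc]; omega)
    have hu : X[i] ∈ X := List.getElem_mem _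
    have hv : X[i + 1] ∈ X := List.getElem_mem _
    have hub := hdis _ hu _ hb
    have hud := hdis _ hu _ hd
    have hvb := hdis _ hv _ hb
    have hvd := hdis _ hv _ hd
    -- That edge separates `b` from `d`, so some edge of `Y` changes sides of it.
    have key : ∃ (j : ℕ) (hj : j + 1 < Y.length), ¬ (Cyc h X[i] Y[j] X[i+1] ↔
        Cyc h X[i] Y[j + 1] X[i+1]) := by
      have : (Cyc h X[i] b X[i + 1] ∧ ¬ Cyc h X[i] d X[i + 1]) ∨
          (Cyc h X[i] d X[i + 1] ∧ ¬ Cyc h X[i] b X[i + 1]) := by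
        simp only [Cyc] at hch ⊢
        omega
      rcases this with ⟨h1, h2⟩ | ⟨h1, h2⟩
      · exact exists_succ_change (fun w => Cyc h X[i] w X[i + 1]) Y b d hb hd h1 h2
      · exact exists_succ_change (fun w => Cyc h X[i] w X[i + 1]) Y d b hd hb h1 h2
    obtain ⟨j, hj, hch'⟩ := key
    have hwu := hdis _ hu _ (List.getElem_mem (l := Y) (n := j) (by omega))
    have hwv := hdis _ hv _ (List.getElem_mem (l := Y) (n := j) (by omega))
    have hxu := hdis _ hu _ (List.getElem_mem (l := Y) (n := j + 1) hj)
    have hxv := hdis _ hv _ (List.getElem_mem (l := Y) (n := j + 1) hj)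
    have hmeet : (segment ℝ (p X[i]) (p X[i + 1]) ∩ segment ℝ (p Y[j]) (p Y[j + 1])).Nonempty := by
      have : Alternate h X[i] Y[j] X[i + 1] Y[j + 1] ∨ Alternate h X[i] Y[j + 1] X[i + 1] Y[j] := by
        simp only [Alternate, Cyc] at hch' ⊢
        omega
      rcases this with h1 | h1
      · exact h1.segments_meet H
      · rw [segment_symm ℝ (p Y[j])]
        exact h1.segments_meet H
    obtain ⟨x, hx⟩ := hmeet
    have hsub := hN i (X.length + j) (by omega) (by simp; omega)
    have e1 : (X ++ Y)[i]'(by simp; omega) = X[i] := List.getElem_append_left _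
    have e2 : (X ++ Y)[i + 1]'(by simp; omega) = X[i + 1] := List.getElem_append_left _
    have e3 : (X ++ Y)[X.length + j]'(by simp; omega) = Y[j] := by
      rw [List.getElem_append_right (by omega)]; congr 1; omega
    have e4 : (X ++ Y)[X.length + j + 1]'(by simp; omega) = Y[j + 1] := by
      rw [List.getElem_append_right (by omega)]; congr 1; omega
    rw [e1, e2, e3, e4] at hsub
    have := (hsub hx).1
    omega
  · intro hS i j hij hj
    have hne : ∀ (a b : ℕ) (ha : a < τ.length) (hb : b < τ.length), a ≠ b → τ[a] ≠ τ[b] :=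
      fun a b ha hb hab hh => hab ((List.Nodup.getElem_inj_iff hτ).1 hh)
    by_cases hji : j = i + 1
    · subst hji
      intro x hx
      refine ⟨rfl, ?_⟩
      exact segments_inter_subset_of_orient_ne_zero (orient_ne_zero_of_ne H
        (hne _ _ _ _ (by omega)) (hne _ _ _ _ (by omega)) (hne _ _ _ _ (by omega))) hx
    -- The cut falls just after edge `i`; since `j ≥ i + 2`, edge `j` lies in the suffix.
    · have hsep := hS (τ.take (i + 2)) (τ.drop (i + 2)) (List.take_append_drop _ _).symm
      have hmt : ∀ (a : ℕ) (ha : a < τ.length), a < i + 2 → τ[a] ∈ τ.take (i + 2) := by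
        intro a ha h2
        rw [List.mem_take_iff_getElem]
        exact ⟨a, by omega, rfl⟩
      have hmd : ∀ (a : ℕ) (ha : a < τ.length), i + 2 ≤ a → τ[a] ∈ τ.drop (i + 2) := by
        intro a ha h2
        rw [List.mem_drop_iff_getElem]
        exact ⟨a - (i + 2), by omega, by congr 1; omega⟩
      have hd := disjoint_segments_of_not_alternate H
        (hne i (i+1) (by omega) (by omega) (by omega)) (hne i j (by omega) (by omega) (by omega))
        (hne i (j+1) (by omega) (by omega) (by omega))
        (hne (i+1) j (by omega) (by omega) (by omega))
        (hne (i+1) (j+1) (by omega) (by omega) (by omega))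
        (hsep _ (hmt _ _ (by omega)) _ (hmt _ _ (by omega)) _ (hmd _ _ (by omega)) _
          (hmd _ _ (by omega)))
        (hsep _ (hmt _ _ (by omega)) _ (hmt _ _ (by omega)) _ (hmd _ _ (by omega)) _
          (hmd _ _ (by omega)))
      rw [hd.inter_eq]
      exact Set.empty_subset _

/-! ### Boundary neighbours and growing sequences -/

/-- `y` and `z` are successive on the hull boundary. -/
def HullAdj {n : ℕ} (h : Equiv.Perm (Fin n)) (y z : Fin n) : Prop :=
  next h y = z ∨ next h z = y

theorem HullAdj.symm {n : ℕ} {h : Equiv.Perm (Fin n)} {y z : Fin n} (H : HullAdj h y z) :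
    HullAdj h z y := Or.symm H

theorem next_injective {n : ℕ} (h : Equiv.Perm (Fin n)) : Function.Injective (next h) := by
  intro a b hab
  simpa [next] using hab

theorem exists_next_eq {n : ℕ} (h : Equiv.Perm (Fin n)) (y : Fin n) : ∃ x, next h x = y :=
  (Finite.injective_iff_surjective.1 (next_injective h)) y

/-- No label lies between hull neighbours, so a chord that avoids both as ends has them on the same
side. -/
theorem HullAdj.cyc_iff {n : ℕ} {h : Equiv.Perm (Fin n)} {b d y z : Fin n} (H : HullAdj h y z)
    (hyb : y ≠ b) (hyd : y ≠ d) (hzb : z ≠ b) (hzd : z ≠ d) : Cyc h b y d ↔ Cyc h b z d := by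
  rw [Ne, ← pos_inj (h := h)] at hyb hyd hzb hzd
  have := pos_lt h b
  have := pos_lt h d
  have := pos_lt h y
  have := pos_lt h z
  rcases H with rfl | rfl
  · have := pos_next h y
    simp only [Cyc]
    split_ifs at this <;> omega
  · have := pos_next h z
    simp only [Cyc]
    split_ifs at this <;> omega

/-- Every element after the first one is a boundary neighbour of an earlier one. -/
def Grows {n : ℕ} (h : Equiv.Perm (Fin n)) (τ : List (Fin n)) : Prop :=
  ∀ l₁ y l₂, τ = l₁ ++ y :: l₂ → l₁ ≠ [] → ∃ z ∈ l₁, HullAdj h z y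

theorem Grows.of_append {n : ℕ} {h : Equiv.Perm (Fin n)} {l l' : List (Fin n)}
    (H : Grows h (l ++ l')) : Grows h l := by
  rintro l₁ y l₂ rfl hne
  exact H l₁ y (l₂ ++ l') (by simp) hne

theorem grows_singleton {n : ℕ} (h : Equiv.Perm (Fin n)) (x : Fin n) : Grows h [x] := by
  intro l₁ y l₂ he hne
  have := congrArg List.length he
  have := List.length_pos_iff.2 hne
  simp at *
  omega

theorem Grows.append {n : ℕ} {h : Equiv.Perm (Fin n)} {l e : List (Fin n)} (H : Grows h l)
    (he : ∀ y ∈ e, ∃ z ∈ l, HullAdj h z y) : Grows h (l ++ e) := by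
  intro l₁ y l₂ heq hne
  rw [List.append_eq_append_iff] at heq
  rcases heq with ⟨m, rfl, rfl⟩ | ⟨m, rfl, hm⟩
  · obtain ⟨z, hz, hadj⟩ := he y (by simp)
    exact ⟨z, by simp [hz], hadj⟩
  · cases m with
    | nil =>
      obtain ⟨z, hz, hadj⟩ := he y (by simp at hm; simp [← hm])
      exact ⟨z, by simpa using hz, hadj⟩
    | cons w m =>
      simp only [List.cons_append, List.cons.injEq] at hm
      obtain ⟨rfl, -⟩ := hm
      exact H l₁ y m rfl hne

/-- Each new label is on the same side of the chord `b d` as the neighbour it attaches to. This is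
the form in which it is used that a growing sequence occupies an arc. -/
theorem Grows.same_side {n : ℕ} {h : Equiv.Perm (Fin n)} {b d : Fin n} {l : List (Fin n)}
    (H : Grows h l) (hb : b ∉ l) (hd : d ∉ l) {u v : Fin n} (hu : u ∈ l) (hv : v ∈ l)
    (hc : Cyc h b u d) : Cyc h b v d := by
  have key : ∀ u ∈ l, ∀ v ∈ l, (Cyc h b u d ↔ Cyc h b v d) := by
    clear hu hv hc u v
    induction l using List.reverseRecOn with
    | nil => simp
    | append_singleton l y ih =>
      simp only [List.mem_append, List.mem_singleton, not_or] at hb hd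
      have ih := ih H.of_append hb.1 hd.1
      rcases List.eq_nil_or_concat l with rfl | ⟨l', w, hl⟩
      · simp
      have hne : l ≠ [] := by rintro rfl; simp at hl
      obtain ⟨z, hz, hadj⟩ := H l y [] rfl hne
      have hzy := hadj.cyc_iff (b := b) (d := d) (fun e => hb.1 (e ▸ hz)) (fun e => hd.1 (e ▸ hz))
        (Ne.symm hb.2) (Ne.symm hd.2)
      intro u hu v hv
      simp only [List.mem_append, List.mem_singleton] at hu hv
      rcases hu with hu | rfl <;> rcases hv with hv | rfl
      · exact ih u hu v hv
      · exact (ih u hu z hz).trans hzy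
      · exact hzy.symm.trans (ih z hz v hv)
      · exact Iff.rfl
  exact (key u hu v hv).1 hc

/-- A growing sequence that meets a set and its complement contains neighbours on both sides. -/
theorem Grows.exists_adj {n : ℕ} {h : Equiv.Perm (Fin n)} {l : List (Fin n)} (H : Grows h l)
    (S : Fin n → Prop) {s t : Fin n} (hs : s ∈ l) (ht : t ∈ l) (hSs : S s) (hSt : ¬ S t) :
    ∃ a ∈ l, ∃ b ∈ l, S a ∧ ¬ S b ∧ HullAdj h a b := by
  by_contra hcon
  push Not at hcon
  have key : ∀ u ∈ l, ∀ v ∈ l, (S u ↔ S v) := by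
    clear hs ht hSs hSt s t
    induction l using List.reverseRecOn with
    | nil => simp
    | append_singleton l y ih =>
      have ih := ih H.of_append fun a ha b hb => hcon a (by simp [ha]) b (by simp [hb])
      rcases List.eq_nil_or_concat l with rfl | ⟨l', w, hl⟩
      · simp
      have hne : l ≠ [] := by rintro rfl; simp at hl
      obtain ⟨z, hz, hadj⟩ := H l y [] rfl hne
      have hzy : S z ↔ S y := by
        by_contra hh
        by_cases hSz : S z
        · exact hcon z (by simp [hz]) y (by simp) hSz (by tauto) hadj
        · exact hcon y (by simp) z (by simp [hz]) (by tauto) hSz hadj.symm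
      intro u hu v hv
      simp only [List.mem_append, List.mem_singleton] at hu hv
      rcases hu with hu | rfl <;> rcases hv with hv | rfl
      · exact ih u hu v hv
      · exact (ih u hu z hz).trans hzy
      · exact hzy.symm.trans (ih z hz v hv)
      · exact Iff.rfl
  exact hSt ((key s hs t ht).1 hSs)

theorem alternate_of_next {n : ℕ} {h : Equiv.Perm (Fin n)} {x y u z : Fin n} (hx : next h x = y)
    (hu : next h y = u) (hzy : z ≠ y) (hzu : z ≠ u) (hzx : z ≠ x) : Alternate h y u z x := by
  rw [Ne, ← pos_inj (h := h)] at hzy hzu hzx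
  have := pos_lt h z
  have := pos_lt h x
  have := pos_lt h y
  have h1 := pos_next h x
  have h2 := pos_next h y
  rw [hx] at h1
  rw [hu] at h2
  simp only [Alternate, Cyc]
  split_ifs at h1 h2 <;> omega

theorem cyc_of_next_left {n : ℕ} {h : Equiv.Perm (Fin n)} {y z : Fin n}
    (hzy : z ≠ y) (hzu : z ≠ next h y) : Cyc h y (next h y) z := by
  rw [Ne, ← pos_inj (h := h)] at hzy hzu
  have := pos_lt h z
  have := pos_lt h y
  have h1 := pos_next h y
  simp only [Cyc]
  split_ifs at h1 <;> omega

/-- Otherwise both hull neighbours of `y` lie in `l₂`, and the chord joining them cuts `y` off from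
every label of `l₁`. -/
theorem exists_adj_of_separated {n : ℕ} {h : Equiv.Perm (Fin n)} {l₁ l₂ : List (Fin n)} {y : Fin n}
    (H : Separated h (l₁ ++ [y]) l₂) (hne : l₁ ≠ []) (hy : y ∉ l₁)
    (hadj : ∀ w, HullAdj h w y → w ∈ l₁ ++ y :: l₂) : ∃ z ∈ l₁, HullAdj h z y := by
  by_contra hcon
  push Not at hcon
  obtain ⟨z, hz⟩ := List.exists_mem_of_ne_nil l₁ hne
  obtain ⟨x, hx⟩ := exists_next_eq h y
  have hzy : z ≠ y := fun e => hy (e ▸ hz)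
  have hzu : z ≠ next h y := fun e => hcon z hz (Or.inr e.symm)
  have hzx : z ≠ x := fun e => hcon z hz (Or.inl (e ▸ hx))
  have hA := alternate_of_next hx rfl hzy hzu hzx
  have hmem : ∀ w, HullAdj h w y → w ≠ y → w ∈ l₂ := by
    intro w hw hwy
    have := hadj w hw
    simp only [List.mem_append, List.mem_cons] at this
    rcases this with h1 | h1 | h1
    · exact absurd hw (hcon w h1)
    · exact absurd h1 hwy
    · exact h1
  refine H y (by simp) z (by simp [hz]) _ (hmem _ (Or.inr rfl) ?_) x (hmem x (Or.inl hx) ?_) hA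
  · intro e
    revert hA
    rw [e]
    simp only [Alternate, Cyc]
    omega
  · intro e
    revert hA
    rw [e]
    simp only [Alternate, Cyc]
    omega

/-- Growth confines a prefix to one side of any suffix chord. In the other direction both hull
neighbours of each label are available, since all labels are listed. -/
theorem grows_iff_separated {n : ℕ} {h : Equiv.Perm (Fin n)} {τ : List (Fin n)} (hτ : τ.Nodup)
    (hall : ∀ y, y ∈ τ) : Grows h τ ↔ ∀ l₁ l₂, τ = l₁ ++ l₂ → Separated h l₁ l₂ := by
  constructor
  · rintro H l₁ l₂ rfl a ha c hc b hb d hd hA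
    have hdis := (List.nodup_append.1 hτ).2.2
    have := H.of_append.same_side (b := b) (d := d) (fun hh => hdis _ hh _ hb rfl)
      (fun hh => hdis _ hh _ hd rfl) hc ha (by
        revert hA
        simp only [Alternate, Cyc]
        omega)
    revert hA this
    simp only [Alternate, Cyc]
    omega
  · rintro H l₁ y l₂ rfl hne
    refine exists_adj_of_separated (H (l₁ ++ [y]) l₂ (by simp)) hne ?_ fun w _ => hall w
    intro hy
    exact (List.nodup_append.1 hτ).2.2 y hy y (by simp) rfl

/-- Growth itself is not visibly symmetric, but separation of prefix and suffix is. -/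
theorem Grows.reverse {n : ℕ} {h : Equiv.Perm (Fin n)} {τ : List (Fin n)} (H : Grows h τ)
    (hτ : τ.Nodup) (hall : ∀ y, y ∈ τ) : Grows h τ.reverse := by
  rw [grows_iff_separated (by simpa using hτ) (by simpa using hall)]
  intro l₁ l₂ he
  rw [grows_iff_separated hτ hall] at H
  refine (H l₂.reverse l₁.reverse ?_).symm.mono (by simp) (by simp)
  rw [← List.reverse_append, ← he, List.reverse_reverse]

theorem isCompatible_univ_iff {n : ℕ} {p q : Fin n → Plane} {hP hQ : Equiv.Perm (Fin n)}
    (HP : IsHullOrder p hP) (HQ : IsHullOrder q hQ) {τ : List (Fin n)} :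
    IsCompatible p q Set.univ τ ↔ τ.Nodup ∧ (∀ y, y ∈ τ) ∧ Grows hP τ ∧ Grows hQ τ := by
  constructor
  · rintro ⟨h1, h2, h3, h4⟩
    have hall : ∀ y, y ∈ τ := fun y => (h2 y).2 trivial
    exact ⟨h1, hall, (grows_iff_separated h1 hall).2 ((isNoncrossing_iff_separated HP h1).1 h3),
      (grows_iff_separated h1 hall).2 ((isNoncrossing_iff_separated HQ h1).1 h4)⟩
  · rintro ⟨h1, hall, h3, h4⟩
    exact ⟨h1, fun y => by simp [hall y],
      (isNoncrossing_iff_separated HP h1).2 ((grows_iff_separated h1 hall).1 h3),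
      (isNoncrossing_iff_separated HQ h1).2 ((grows_iff_separated h1 hall).1 h4)⟩

/-! ### Sets of labels that cannot be extended -/

/-- The greedy construction cannot extend the labels in `l`. -/
def Stuck {n : ℕ} (hP hQ : Equiv.Perm (Fin n)) (l : List (Fin n)) : Prop :=
  outerLabels hP l ∩ outerLabels hQ l = ∅

theorem mem_outerLabels_iff {n : ℕ} {h : Equiv.Perm (Fin n)} {l : List (Fin n)} {y : Fin n} :
    y ∈ outerLabels h l ↔ y ∉ l ∧ ∃ z ∈ l, HullAdj h z y := by
  simp only [outerLabels, Set.mem_ofPred_eq, HullAdj]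
  refine and_congr_right fun _ => ⟨?_, ?_⟩
  · rintro (h1 | ⟨z, hz, h1⟩)
    · exact ⟨_, h1, Or.inr rfl⟩
    · exact ⟨z, hz, Or.inl h1⟩
  · rintro ⟨z, hz, h1 | h1⟩
    · exact Or.inr ⟨z, hz, h1⟩
    · exact Or.inl (h1 ▸ hz)

theorem Stuck.mem {n : ℕ} {hP hQ : Equiv.Perm (Fin n)} {A : List (Fin n)} (HA : Stuck hP hQ A)
    {u v y : Fin n} (hu : u ∈ A) (hv : v ∈ A) (hP' : HullAdj hP u y) (hQ' : HullAdj hQ v y) :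
    y ∈ A := by
  by_contra hy
  have : y ∈ outerLabels hP A ∩ outerLabels hQ A :=
    ⟨mem_outerLabels_iff.2 ⟨hy, u, hu, hP'⟩, mem_outerLabels_iff.2 ⟨hy, v, hv, hQ'⟩⟩
  rw [HA] at this
  exact this

theorem exists_first_not {α : Type*} (S : α → Prop) : ∀ (l : List α), (∃ w ∈ l, ¬ S w) →
    ∃ l₁ y l₂, l = l₁ ++ y :: l₂ ∧ (∀ u ∈ l₁, S u) ∧ ¬ S y
  | [], h => by simp at h
  | x :: l, h => by
    by_cases hx : S x
    · obtain ⟨l₁, y, l₂, rfl, h1, h2⟩ := exists_first_not S l (by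
        obtain ⟨w, hw, hSw⟩ := h
        rcases List.mem_cons.1 hw with rfl | hw
        · exact absurd hx hSw
        · exact ⟨w, hw, hSw⟩)
      exact ⟨x :: l₁, y, l₂, rfl, by simpa [hx] using h1, h2⟩
    · exact ⟨[], x, l, rfl, by simp, hx⟩

/-- The first label outside `A` would have a neighbour in `A` on each hull. -/
theorem Stuck.subset_of_grows {n : ℕ} {hP hQ : Equiv.Perm (Fin n)} {A τ : List (Fin n)}
    (HA : Stuck hP hQ A) (h1 : Grows hP τ) (h2 : Grows hQ τ) {x : Fin n}
    (hx : τ.head? = some x) (hxA : x ∈ A) : τ ⊆ A := by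
  by_contra hcon
  obtain ⟨l₁, y, l₂, rfl, hl, hy⟩ := exists_first_not (· ∈ A) τ (by
    simpa [List.subset_def] using hcon)
  have hne : l₁ ≠ [] := by
    rintro rfl
    simp at hx
    exact hy (hx ▸ hxA)
  obtain ⟨u, hu, hu'⟩ := h1 l₁ y l₂ rfl hne
  obtain ⟨v, hv, hv'⟩ := h2 l₁ y l₂ rfl hne
  exact hy (HA.mem (hl u hu) (hl v hv) hu' hv')

theorem exists_not_mem_of_length_lt {n : ℕ} {l : List (Fin n)} (hl : l.length < n) :
    ∃ w, w ∉ l := by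
  by_contra hcon
  push Not at hcon
  have h1 : (Finset.univ : Finset (Fin n)) ⊆ l.toFinset := fun w _ => by simpa using hcon w
  have h2 := Finset.card_le_card h1
  have h3 := l.toFinset_card_le
  simp at h2
  omega

theorem length_le_of_nodup {n : ℕ} {l : List (Fin n)} (hl : l.Nodup) : l.length ≤ n := by
  simpa using hl.length_le_card

theorem mem_of_nodup_of_le_length {n : ℕ} {l : List (Fin n)} (hl : l.Nodup) (hn : n ≤ l.length)
    (y : Fin n) : y ∈ l := by
  have : l.toFinset = Finset.univ := by
    apply Finset.eq_univ_of_card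
    rw [List.toFinset_card_of_nodup hl, Fintype.card_fin]
    exact le_antisymm (length_le_of_nodup hl) hn
  rw [← List.mem_toFinset, this]
  exact Finset.mem_univ y

theorem Stuck.not_hasCompatibleFrom {n : ℕ} {p q : Fin n → Plane} {hP hQ : Equiv.Perm (Fin n)}
    (HP : IsHullOrder p hP) (HQ : IsHullOrder q hQ) {A : List (Fin n)} (HA : Stuck hP hQ A)
    (hlen : A.length < n) {y : Fin n} (hy : y ∈ A) : ¬ HasCompatibleFrom p q Set.univ y := by
  rintro ⟨τ, hτ, hhead⟩
  obtain ⟨-, hall, h1, h2⟩ := (isCompatible_univ_iff HP HQ).1 hτ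
  obtain ⟨w, hw⟩ := exists_not_mem_of_length_lt hlen
  exact hw (HA.subset_of_grows h1 h2 hhead hy (hall w))

/-! ### The greedy construction -/

theorem GreedyStage.grows {n : ℕ} {hP hQ : Equiv.Perm (Fin n)} {x : Fin n} {l : List (Fin n)}
    (H : GreedyStage hP hQ x l) : l.Nodup ∧ Grows hP l ∧ Grows hQ l ∧ l.head? = some x := by
  induction H with
  | start => exact ⟨by simp, grows_singleton _ _, grows_singleton _ _, rfl⟩
  | step l e _ _ hnd hmem ih =>
    obtain ⟨h1, h2, h3, h4⟩ := ih
    refine ⟨?_, h2.append fun y hy => ?_, h3.append fun y hy => ?_, ?_⟩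
    · rw [List.nodup_append]
      refine ⟨h1, hnd, ?_⟩
      rintro a ha b hb rfl
      exact (mem_outerLabels_iff.1 ((hmem a).1 hb).1).1 ha
    · exact (mem_outerLabels_iff.1 ((hmem y).1 hy).1).2
    · exact (mem_outerLabels_iff.1 ((hmem y).1 hy).2).2
    · rw [List.head?_append, h4]
      rfl

open Classical in
-- Stages have no repeated labels, so each proper step lowers the number of missing labels, which
-- `k` bounds.
theorem exists_isGreedy_of_greedyStage {n : ℕ} {hP hQ : Equiv.Perm (Fin n)} {x : Fin n} :
    ∀ (k : ℕ) (l : List (Fin n)), n - l.length ≤ k → GreedyStage hP hQ x l →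
      ∃ σ, IsGreedy hP hQ x σ
  | 0, l, hk, H => by
    refine ⟨l, H, Set.eq_empty_of_forall_notMem fun y hy => ?_⟩
    exact (mem_outerLabels_iff.1 hy.1).1 (mem_of_nodup_of_le_length H.grows.1 (by omega) y)
  | k + 1, l, hk, H => by
    by_cases hs : outerLabels hP l ∩ outerLabels hQ l = ∅
    · exact ⟨l, H, hs⟩
    · obtain ⟨y, hy⟩ := Set.nonempty_iff_ne_empty.2 hs
      set e := (Finset.univ.filter (· ∈ outerLabels hP l ∩ outerLabels hQ l)).toList with he
      have hmem : ∀ y, y ∈ e ↔ y ∈ outerLabels hP l ∩ outerLabels hQ l := by simp [he]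
      have hlen : 0 < e.length := List.length_pos_of_mem ((hmem y).2 hy)
      refine exists_isGreedy_of_greedyStage k (l ++ e) ?_
        (.step l e H (List.length_pos_iff.1 hlen) (Finset.nodup_toList _) hmem)
      rw [List.length_append]
      omega

theorem exists_isGreedy {n : ℕ} (hP hQ : Equiv.Perm (Fin n)) (x : Fin n) :
    ∃ σ, IsGreedy hP hQ x σ :=
  exists_isGreedy_of_greedyStage _ [x] le_rfl .start

theorem isCompatible_of_grows {n : ℕ} {p q : Fin n → Plane} {hP hQ : Equiv.Perm (Fin n)}
    (HP : IsHullOrder p hP) (HQ : IsHullOrder q hQ) {l : List (Fin n)} (h1 : l.Nodup)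
    (h2 : Grows hP l) (h3 : Grows hQ l) (hlen : n ≤ l.length) : IsCompatible p q Set.univ l :=
  (isCompatible_univ_iff HP HQ).2 ⟨h1, mem_of_nodup_of_le_length h1 hlen, h2, h3⟩

/-! ### Common intervals -/

/-- The suffix from `v` on is an arc meeting both `A` and its complement, so it contains a label `b`
just outside one end of `A`. Cutting the hull at `b` makes the order linear, with `A` at one end;
the prefix before `v` then lies beyond `v`, and `u` is its label nearest to `v`. As `v` attaches to
the prefix, it attaches to `u`. -/
theorem adj_of_consecutive {n : ℕ} {h : Equiv.Perm (Fin n)} {A τ B₁ B₂ C : List (Fin n)}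
    {u v z t : Fin n} (hA : Grows h A) (hτ : Grows h τ) (hnd : τ.Nodup) (hall : ∀ y, y ∈ τ)
    (he : τ = (B₁ ++ u :: B₂) ++ v :: C) (hu : u ∈ A) (hv : v ∈ A) (hB₂ : ∀ w ∈ B₂, w ∉ A)
    (hz : z ∈ B₁) (hzA : z ∉ A) (ht : t ∈ C) (htA : t ∉ A) : HullAdj h u v := by
  have hrev := hτ.reverse hnd hall
  subst he
  rw [List.reverse_append] at hrev
  obtain ⟨s, -, b, hb, hs, hbA, hsb⟩ := hrev.of_append.exists_adj (· ∈ A) (s := v) (t := t)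
    (by simp) (by simp [ht]) hv htA
  have hbC : b ∈ v :: C := List.mem_reverse.1 hb
  have hdis := (List.nodup_append.1 hnd).2.2
  have hbB : b ∉ B₁ ++ u :: B₂ := fun hh => hdis b hh b hbC rfl
  have hvB : v ∉ B₁ ++ u :: B₂ := fun hh => hdis v hh v (by simp) rfl
  have huB : u ∉ B₁ := fun hh =>
    (List.nodup_append.1 (List.nodup_append.1 hnd).1).2.2 u hh u (by simp) rfl
  have hbB₁ : b ∉ B₁ := fun hh => hbB (by simp [hh])
  have hzB : z ∈ B₁ ++ u :: B₂ := by simp [hz]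
  obtain ⟨w, hw, hwv⟩ := hτ (B₁ ++ u :: B₂) v C rfl (by simp)
  have hgB : Grows h (B₁ ++ u :: B₂) := hτ.of_append
  have hgB₁ : Grows h B₁ := hgB.of_append
  have hbu : pos h b ≠ pos h u := fun e => hbA (pos_inj.1 e ▸ hu)
  have hbv : pos h b ≠ pos h v := fun e => hbA (pos_inj.1 e ▸ hv)
  have hposu := pos_lt h u
  have hposv := pos_lt h v
  have hposw := pos_lt h w
  have huv : pos h u ≠ pos h v := by
    intro e
    exact hvB (by simp [pos_inj.1 e])
  rcases hsb with hsb | hsb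
  -- Read counterclockwise from `b`, the labels outside `A` come first and those of `A` follow,
  -- ending with `s`.
  · have side : ∀ y, y ∉ A → y ≠ b → ∀ x ∈ A, Cyc h b y x := by
      intro y hy hyb x hx
      have h0 : Cyc h s b y := by
        have := cyc_of_next_left (h := h) (y := s) (z := y) (fun e => hy (e ▸ hs)) (by rwa [hsb])
        rwa [hsb] at this
      have := hA.same_side hy hbA hs hx h0.rotate
      exact this.rotate
    have hBv := fun y hy => hgB.same_side hbB hvB hzB hy
      (side z hzA (fun e => hbB (e ▸ hzB)) v hv) (v := y)
    have hBu : ∀ y ∈ B₁ ++ u :: B₂, y = u ∨ Cyc h b y u := by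
      intro y hy
      simp only [List.mem_append, List.mem_cons] at hy
      rcases hy with hy | hy | hy
      · exact Or.inr (hgB₁.same_side hbB₁ huB hz hy (side z hzA (fun e => hbB (e ▸ hzB)) u hu))
      · exact Or.inl hy
      · exact Or.inr (side y (hB₂ y hy) (fun e => hbB (by simp [← e, hy])) u hu)
    -- In this reading `w` is at or before `u`, which is before `v`; a neighbour of `v` other than
    -- `u` would have to skip `u` or wrap around past `b`.
    rcases hBu w hw with rfl | hwu
    · exact hwv
    · exfalso
      have huv' := hBv u (by simp)
      have hwv' := hBv w hw
      have := pos_lt h b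
      rcases hwv with hwv | hwv
      · have := pos_next h w
        rw [hwv] at this
        simp only [Cyc] at huv' hwv' hwu
        split_ifs at this <;> omega
      · have := pos_next h v
        rw [hwv] at this
        simp only [Cyc] at huv' hwv' hwu
        split_ifs at this <;> omega
  -- The mirror image, read clockwise from `b`.
  · have side : ∀ y, y ∉ A → y ≠ b → ∀ x ∈ A, Cyc h x y b := by
      intro y hy hyb x hx
      have h0 : Cyc h b s y := by
        have := cyc_of_next_left (h := h) (y := b) (z := y) hyb (by rw [hsb]; rintro rfl; exact hy hs)
        rwa [hsb] at this
      have := hA.same_side hbA hy hs hx h0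
      exact this.rotate.rotate
    have hBv := fun y hy => hgB.same_side hvB hbB hzB hy
      (side z hzA (fun e => hbB (e ▸ hzB)) v hv) (v := y)
    have hBu : ∀ y ∈ B₁ ++ u :: B₂, y = u ∨ Cyc h u y b := by
      intro y hy
      simp only [List.mem_append, List.mem_cons] at hy
      rcases hy with hy | hy | hy
      · exact Or.inr (hgB₁.same_side huB hbB₁ hz hy (side z hzA (fun e => hbB (e ▸ hzB)) u hu))
      · exact Or.inl hy
      · exact Or.inr (side y (hB₂ y hy) (fun e => hbB (by simp [← e, hy])) u hu)
    rcases hBu w hw with rfl | hwu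
    · exact hwv
    · exfalso
      have huv' := hBv u (by simp)
      have hwv' := hBv w hw
      have := pos_lt h b
      rcases hwv with hwv | hwv
      · have := pos_next h w
        rw [hwv] at this
        simp only [Cyc] at huv' hwv' hwu
        split_ifs at this <;> omega
      · have := pos_next h v
        rw [hwv] at this
        simp only [Cyc] at huv' hwv' hwu
        split_ifs at this <;> omega

theorem isChain_filter {α : Type*} (S : α → Bool) (R : α → α → Prop) : ∀ (τ : List α),
    (∀ B₁ u B₂ v C, τ = (B₁ ++ u :: B₂) ++ v :: C → S u → S v → (∀ w ∈ B₂, ¬ S w) → R u v) →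
      (τ.filter S).IsChain R
  | [], _ => by simp
  | x :: τ, H => by
    have ih := isChain_filter S R τ fun B₁ u B₂ v C he => H (x :: B₁) u B₂ v C (by simp [he])
    by_cases hx : S x
    · rw [List.filter_cons_of_pos hx, List.isChain_cons]
      refine ⟨fun v hv => ?_, ih⟩
      rw [Option.mem_def, List.head?_eq_some_iff] at hv
      obtain ⟨as, has⟩ := hv
      obtain ⟨l₁, l₂, rfl, h1, h2, -⟩ := List.filter_eq_cons_iff.1 has
      exact H [] x l₁ v l₂ (by simp) hx h2 h1
    · rw [List.filter_cons_of_neg hx]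
      exact ih

/-- A chain of neighbours cannot change direction without repeating a label. -/
theorem isInterval_of_isChain_adj {n : ℕ} {h : Equiv.Perm (Fin n)} {L : List (Fin n)}
    (hL : L.Nodup) (hc : L.IsChain (HullAdj h)) : IsInterval h L := by
  refine ⟨hL, ?_⟩
  induction L with
  | nil => simp
  | cons x L ih =>
    cases L with
    | nil => simp
    | cons y L =>
      rw [List.isChain_cons_cons] at hc
      cases L with
      | nil => simpa [HullAdj] using hc.1
      | cons z L =>
        have hxz : x ≠ z := by
          rintro rfl
          simp at hL
        rcases ih (List.nodup_cons.1 hL).2 hc.2 with h1 | h1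
        · rcases hc.1 with h2 | h2
          · exact Or.inl (List.isChain_cons_cons.2 ⟨h2, h1⟩)
          · have := (List.isChain_cons_cons.1 h1).1
            exact absurd (h2.symm.trans this) hxz
        · rcases hc.1 with h2 | h2
          · have := (List.isChain_cons_cons.1 h1).1
            exact absurd (next_injective h (h2.trans this.symm)) hxz
          · exact Or.inr (List.isChain_cons_cons.2 ⟨h2, h1⟩)

/-- The listing is the order in which `τ` visits `A`, hence the same one for both hulls. That `τ`
and its reverse start outside `A` provides the outside labels needed before and after each pair. -/
theorem Stuck.exists_isInterval {n : ℕ} {p q : Fin n → Plane} {hP hQ : Equiv.Perm (Fin n)}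
    (HP : IsHullOrder p hP) (HQ : IsHullOrder q hQ) {A : List (Fin n)} (HA : Stuck hP hQ A)
    (hlen : A.length < n) (hnd : A.Nodup) (hAP : Grows hP A) (hAQ : Grows hQ A)
    (hex : ∃ τ : List (Fin n), IsCompatible p q Set.univ τ) :
    ∃ L : List (Fin n), L.Perm A ∧ IsInterval hP L ∧ IsInterval hQ L := by
  obtain ⟨τ, hτ⟩ := hex
  obtain ⟨hτn, hall, hτP, hτQ⟩ := (isCompatible_univ_iff HP HQ).1 hτ
  obtain ⟨w, hw⟩ := exists_not_mem_of_length_lt hlen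
  have hlN : (τ.filter (· ∈ A)).Nodup := hτn.filter _
  have hstart : ∀ (ρ : List (Fin n)), Grows hP ρ → Grows hQ ρ → (∀ y, y ∈ ρ) →
      ∀ z, ρ.head? = some z → z ∉ A := fun ρ h1 h2 h3 z hz hzA =>
    hw (HA.subset_of_grows h1 h2 hz hzA (h3 w))
  have key : ∀ h, Grows h A → Grows h τ → (τ.filter (· ∈ A)).IsChain (HullAdj h) := by
    intro h hA hτh
    refine isChain_filter _ _ τ fun B₁ u B₂ v C he hu hv hB₂ => ?_
    simp only [decide_eq_true_eq] at hu hv hB₂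
    have hz : ∃ z ∈ B₁, z ∉ A := by
      cases B₁ with
      | nil => exact absurd hu (hstart τ hτP hτQ hall u (by simp [he]))
      | cons z B₁ => exact ⟨z, by simp, hstart τ hτP hτQ hall z (by simp [he])⟩
    have ht : ∃ t ∈ C, t ∉ A := by
      have hst := hstart τ.reverse (hτP.reverse hτn hall) (hτQ.reverse hτn hall) (by simpa using hall)
      rcases List.eq_nil_or_concat C with rfl | ⟨C, t, rfl⟩
      · exact absurd hv (hst v (by simp [he]))
      · exact ⟨t, by simp, hst t (by simp [he])⟩
    obtain ⟨z, hz, hzA⟩ := hz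
    obtain ⟨t, ht, htA⟩ := ht
    exact adj_of_consecutive hA hτh hτn hall he hu hv hB₂ hz hzA ht htA
  refine ⟨τ.filter (· ∈ A), ?_, isInterval_of_isChain_adj hlN (key _ hAP hτP),
    isInterval_of_isChain_adj hlN (key _ hAQ hτQ)⟩
  rw [List.perm_ext_iff_of_nodup hlN hnd]
  intro a
  simp [hall a]

theorem IsInterval.isChain_adj {n : ℕ} {h : Equiv.Perm (Fin n)} {L : List (Fin n)}
    (H : IsInterval h L) : L.IsChain (HullAdj h) :=
  H.2.elim (fun hc => hc.imp fun _ _ => Or.inl) (fun hc => hc.imp fun _ _ => Or.inr)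

theorem iff_of_isChain {α : Type*} {R : α → α → Prop} {S : α → Prop} {L : List α}
    (hc : L.IsChain R) (hR : ∀ a b, R a b → (S a ↔ S b)) : ∀ u ∈ L, ∀ v ∈ L, (S u ↔ S v) := by
  induction L with
  | nil => simp
  | cons x L ih =>
    have ih := ih hc.tail
    cases L with
    | nil => simp
    | cons y L =>
      have hxy := hR _ _ (List.isChain_cons_cons.1 hc).1
      intro u hu v hv
      rcases List.mem_cons.1 hu with hu | hu <;> rcases List.mem_cons.1 hv with hv | hv
      · rw [hu, hv]
      · exact hu ▸ hxy.trans (ih y (by simp) v hv)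
      · exact hv ▸ (ih u hu y (by simp)).trans hxy.symm
      · exact ih u hu v hv

/-- Successive labels of `L` are neighbours on both hulls, so membership in `A` passes along `L` in
both directions. -/
theorem Stuck.subset_of_isInterval {n : ℕ} {hP hQ : Equiv.Perm (Fin n)} {A L : List (Fin n)}
    (HA : Stuck hP hQ A) (hLP : IsInterval hP L) (hLQ : IsInterval hQ L) {y : Fin n} (hy : y ∈ L)
    (hyA : y ∈ A) : L ⊆ A := by
  have hc : L.IsChain fun a b => HullAdj hP a b ∧ HullAdj hQ a b := by
    rw [List.isChain_iff_getElem]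
    intro i hi
    exact ⟨List.isChain_iff_getElem.1 hLP.isChain_adj i hi,
      List.isChain_iff_getElem.1 hLQ.isChain_adj i hi⟩
  intro v hv
  refine (iff_of_isChain (S := (· ∈ A)) hc (fun a b hab => ?_) y hy v hv).1 hyA
  exact ⟨fun ha => HA.mem ha ha hab.1 hab.2, fun hb => HA.mem hb hb hab.1.symm hab.2.symm⟩

/-! ### Deleting the interior of a common interval -/

theorem grows_of_isChain {n : ℕ} {h : Equiv.Perm (Fin n)} {L : List (Fin n)}
    (hc : L.IsChain (HullAdj h)) : Grows h L := by
  rintro l₁ y l₂ rfl hne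
  obtain ⟨l, z, rfl⟩ := (List.eq_nil_or_concat l₁).resolve_left hne
  refine ⟨z, by simp, ?_⟩
  rw [List.concat_eq_append, List.append_assoc] at hc
  exact (List.isChain_cons_cons.1 (List.isChain_append.1 hc).2.1).1

theorem exists_rel_of_mem_dropLast {α : Type*} {R : α → α → Prop} : ∀ {L : List α}, L.IsChain R →
    ∀ m ∈ L.dropLast, ∃ b ∈ L.tail, R m b
  | [], _, m, hm => by simp at hm
  | [x], _, m, hm => by simp at hm
  | x :: y :: L, hc, m, hm => by
    rw [List.isChain_cons_cons] at hc
    rw [List.dropLast_cons_cons, List.mem_cons] at hm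
    rcases hm with rfl | hm
    · exact ⟨y, by simp, hc.1⟩
    · obtain ⟨b, hb, hR⟩ := exists_rel_of_mem_dropLast hc.2 m hm
      exact ⟨b, by simp at hb ⊢; exact Or.inr hb, hR⟩

theorem IsInterval.reverse {n : ℕ} {h : Equiv.Perm (Fin n)} {L : List (Fin n)}
    (H : IsInterval h L) : IsInterval h L.reverse := by
  refine ⟨List.nodup_reverse.2 H.1, ?_⟩
  rw [List.isChain_reverse, List.isChain_reverse]
  exact H.2.symm

theorem tail_dropLast_reverse {α : Type*} (L : List α) :
    L.reverse.tail.dropLast = L.tail.dropLast.reverse := by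
  rw [List.tail_reverse, List.dropLast_reverse, ← List.tail_dropLast]

theorem mem_dropLast_of_mem_interior {α : Type*} {L : List α} {m : α} (hm : m ∈ L.tail.dropLast) :
    m ∈ L.dropLast := by
  rw [← List.tail_dropLast] at hm
  exact List.mem_of_mem_tail hm

theorem IsInterval.mem_of_adj_interior {n : ℕ} {h : Equiv.Perm (Fin n)} {L : List (Fin n)}
    (H : IsInterval h L) {m y : Fin n} (hm : m ∈ L.tail.dropLast) (hadj : HullAdj h m y) :
    y ∈ L := by
  have main : ∀ K : List (Fin n), m ∈ K.tail.dropLast → K.IsChain (fun y z => next h y = z) →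
      y ∈ K := by
    intro K hm hc
    obtain ⟨b, hb, hmb⟩ := exists_rel_of_mem_dropLast hc m (mem_dropLast_of_mem_interior hm)
    have hm' : m ∈ K.reverse.dropLast :=
      mem_dropLast_of_mem_interior (by rw [tail_dropLast_reverse]; simpa using hm)
    obtain ⟨a, ha, hma⟩ := exists_rel_of_mem_dropLast (List.isChain_reverse.2 hc) m hm'
    rcases hadj with h1 | h1
    · rw [← h1, hmb]
      exact List.mem_of_mem_tail hb
    · rw [next_injective h (h1.trans (hma : next h a = m).symm)]
      simpa using List.mem_of_mem_tail ha
  rcases H.2 with hc | hc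
  · exact main L hm hc
  · simpa using main L.reverse (by rw [tail_dropLast_reverse]; simpa using hm)
      (List.isChain_reverse.2 hc)

/-- The far end `e` of the interval stands in for the deleted neighbour of `y`. If no label of `l₁`
were next to `y`, then `e` and the neighbour of `y` off the interval would both lie in `l₂`, and
their chord would separate `y` from `l₁`. -/
theorem IsInterval.exists_adj_head {n : ℕ} {h : Equiv.Perm (Fin n)} {L' l₁ l₂ : List (Fin n)}
    {y : Fin n} (H : IsInterval h (y :: L')) (hsep : Separated h (l₁ ++ [y]) l₂) (hne : l₁ ≠ [])
    (hy : y ∉ l₁) (hdis : ∀ w ∈ l₁, w ∉ L')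
    (hall : ∀ w, w ∉ L'.dropLast → w ∈ l₁ ++ y :: l₂) : ∃ z ∈ l₁, HullAdj h z y := by
  obtain ⟨z, hz⟩ := List.exists_mem_of_ne_nil l₁ hne
  rcases List.eq_nil_or_concat L' with rfl | ⟨K, e, rfl⟩
  · exact exists_adj_of_separated hsep hne hy fun w _ => hall w (by simp)
  by_contra hcon
  push Not at hcon
  rw [List.concat_eq_append] at H hdis hall
  rw [List.dropLast_concat] at hall
  have hnd := H.1
  obtain ⟨hyK, hndK⟩ := List.nodup_cons.1 hnd
  have hzL := hdis z hz
  have hzy : z ≠ y := fun e => hy (e ▸ hz)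
  have hl₂ : ∀ w, w ∉ K → w ∉ l₁ → w ≠ y → w ∈ l₂ := by
    intro w h1 h2 h3
    simpa [h2, h3] using hall w h1
  have heK : e ∉ K := fun hh => (List.nodup_append.1 hndK).2.2 e hh e (by simp) rfl
  have he : e ∈ l₂ := hl₂ e heK (fun hh => hdis e hh (by simp)) (by rintro rfl; simp at hyK)
  have hg : Grows h (K ++ [e]) := grows_of_isChain H.isChain_adj.tail
  obtain ⟨b, hb⟩ : ∃ b, b ∈ (K ++ [e]).head? := by
    cases K <;> simp
  have hbK : b ∈ K ++ [e] := List.mem_of_mem_head? hb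
  have hzb : z ≠ b := fun e => hzL (e ▸ hbK)
  obtain ⟨x, hx⟩ := exists_next_eq h y
  have hzu : z ≠ next h y := fun e => hcon z hz (Or.inr e.symm)
  have hzx : z ≠ x := fun e => hcon z hz (Or.inl (e ▸ hx))
  have hA := alternate_of_next hx rfl hzy hzu hzx
  have hK : ∀ w ∈ K, w ∈ (y :: (K ++ [e])).dropLast := by
    intro w hw
    rw [← List.cons_append, List.dropLast_concat]
    simp [hw]
  rcases H.2 with hc | hc
  · have hyb : next h y = b := (List.isChain_cons.1 hc).1 b hb
    have hxK : x ∉ K := by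
      intro hxK
      obtain ⟨w, hw, hxw⟩ := exists_rel_of_mem_dropLast hc x (hK x hxK)
      rw [hx] at hxw
      exact hyK (by simpa [← hxw] using hw)
    have hxl : x ∈ l₂ := hl₂ x hxK (fun hh => hcon x hh (Or.inl hx)) (by
      rintro rfl
      revert hA
      simp only [Alternate, Cyc]
      omega)
    -- The rest of the interval is an arc avoiding `y` and `z`, so `e` is on the same side of the
    -- chord `y z` as the neighbour `b` of `y`.
    have h1 := hg.same_side hyK hzL hbK (show e ∈ K ++ [e] by simp) (hyb ▸ hA.1)
    exact hsep y (by simp) z (by simp [hz]) e he x hxl ⟨h1, hA.2⟩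
  · have hyb : next h b = y := (List.isChain_cons.1 hc).1 b hb
    have hbx : b = x := next_injective h (hyb.trans hx.symm)
    have huK : next h y ∉ K := by
      intro hxK
      obtain ⟨w, hw, hxw⟩ := exists_rel_of_mem_dropLast hc _ (hK _ hxK)
      exact hyK (by simpa [next_injective h hxw] using hw)
    have hul : next h y ∈ l₂ := hl₂ _ huK (fun hh => hcon _ hh (Or.inr rfl)) (by
      intro e
      revert hA
      rw [e]
      simp only [Alternate, Cyc]
      omega)
    have h1 := hg.same_side hzL hyK hbK (show e ∈ K ++ [e] by simp) (hbx ▸ hA.2)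
    exact hsep y (by simp) z (by simp [hz]) _ hul e he ⟨hA.1, h1⟩

theorem IsInterval.exists_adj_end {n : ℕ} {h : Equiv.Perm (Fin n)} {L l₁ l₂ : List (Fin n)}
    {y : Fin n} (H : IsInterval h L) (hyL : y ∈ L) (hyi : y ∉ L.tail.dropLast)
    (hsep : Separated h (l₁ ++ [y]) l₂) (hne : l₁ ≠ []) (hy : y ∉ l₁) (hdis : ∀ w ∈ l₁, w ∉ L)
    (hall : ∀ w, w ∉ L.tail.dropLast → w ∈ l₁ ++ y :: l₂) : ∃ z ∈ l₁, HullAdj h z y := by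
  have main : ∀ K : List (Fin n), IsInterval h K → (∀ w, w ∈ K ↔ w ∈ L) →
      (∀ w, w ∈ K.tail.dropLast ↔ w ∈ L.tail.dropLast) → K.head? = some y →
      ∃ z ∈ l₁, HullAdj h z y := by
    intro K hK h1 h2 h3
    obtain ⟨K, rfl⟩ := List.head?_eq_some_iff.1 h3
    exact hK.exists_adj_head hsep hne hy (fun w hw hwK => hdis w hw ((h1 w).1 (by simp [hwK])))
      fun w hw => hall w fun hh => hw ((h2 w).2 hh)
  cases L with
  | nil => simp at hyL
  | cons x L =>
    rcases List.mem_cons.1 hyL with rfl | hyL'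
    · exact main _ H (fun _ => Iff.rfl) (fun _ => Iff.rfl) rfl
    · rcases List.eq_nil_or_concat L with rfl | ⟨K, e, rfl⟩
      · simp at hyL'
      · have hye : y = e := by
          simpa [show y ∉ K by simpa using hyi] using hyL'
        subst hye
        refine main _ H.reverse (by simp only [List.mem_reverse, implies_true]) (fun w => ?_) (by simp)
        rw [tail_dropLast_reverse, List.mem_reverse]

/-- A label off `L` keeps both hull neighbours under the deletion. A remaining label of `L` is an
end of it, and as `y ∉ B` the whole of `L` misses `B`, hence misses `l₁`. -/
theorem Separated.exists_adj_of_delete {n : ℕ} {h : Equiv.Perm (Fin n)}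
    {L B l₁ l₂ : List (Fin n)} {y : Fin n} (H : IsInterval h L) (hyi : y ∉ L.tail.dropLast)
    (hsep : Separated h (l₁ ++ [y]) l₂) (hne : l₁ ≠ []) (hy : y ∉ B) (hl₁ : l₁ ⊆ B)
    (hLB : ∀ w ∈ L, w ∈ B → L ⊆ B)
    (hall : ∀ w, w ∉ L.tail.dropLast → w ∈ l₁ ++ y :: l₂) : ∃ z ∈ l₁, HullAdj h z y := by
  have hy₁ : y ∉ l₁ := fun hh => hy (hl₁ hh)
  by_cases hyL : y ∈ L
  · exact H.exists_adj_end hyL hyi hsep hne hy₁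
      (fun w hw hwL => hy (hLB w hwL (hl₁ hw) hyL)) hall
  · exact exists_adj_of_separated hsep hne hy₁ fun w hw => hall w fun hwi =>
      hyL (H.mem_of_adj_interior hwi hw)

theorem exists_mem_not_mem_interior {α : Type*} {L : List α} (hnd : L.Nodup) {w : α}
    (hw : w ∈ L) : ∃ f ∈ L, f ∉ L.tail.dropLast := by
  cases L with
  | nil => simp at hw
  | cons f L =>
    exact ⟨f, by simp, fun hh => (List.nodup_cons.1 hnd).1 (List.dropLast_subset _ hh)⟩

theorem Separated.filter {n : ℕ} {h : Equiv.Perm (Fin n)} {τ : List (Fin n)} (S : Fin n → Bool)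
    (H : ∀ l₁ l₂, τ = l₁ ++ l₂ → Separated h l₁ l₂) :
    ∀ l₁ l₂, τ.filter S = l₁ ++ l₂ → Separated h l₁ l₂ := by
  intro l₁ l₂ he
  obtain ⟨k₁, k₂, rfl, rfl, rfl⟩ := List.filter_eq_append_iff.1 he
  exact (H k₁ k₂ rfl).mono List.filter_sublist.subset List.filter_sublist.subset

open Classical in
theorem HasCompatibleFrom.restrict {n : ℕ} {p q : Fin n → Plane} {hP hQ : Equiv.Perm (Fin n)}
    (HP : IsHullOrder p hP) (HQ : IsHullOrder q hQ) {S : Set (Fin n)} {z : Fin n} (hz : z ∈ S)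
    (H : HasCompatibleFrom p q Set.univ z) : HasCompatibleFrom p q S z := by
  obtain ⟨τ, hτ, hhead⟩ := H
  have hnd := hτ.nodup
  refine ⟨τ.filter (· ∈ S), ⟨hnd.filter _, fun y => ?_, ?_, ?_⟩, ?_⟩
  · simp [(hτ.mem_iff y).2 trivial]
  · rw [isNoncrossing_iff_separated HP (hnd.filter _)]
    exact Separated.filter _ ((isNoncrossing_iff_separated HP hnd).1 hτ.noncrossing_left)
  · rw [isNoncrossing_iff_separated HQ (hnd.filter _)]
    exact Separated.filter _ ((isNoncrossing_iff_separated HQ hnd).1 hτ.noncrossing_right)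
  · obtain ⟨τ', rfl⟩ := List.head?_eq_some_iff.1 hhead
    simp [hz]

theorem HasCompatibleFrom.extend_interval {n : ℕ} {p q : Fin n → Plane}
    {hP hQ : Equiv.Perm (Fin n)} (HP : IsHullOrder p hP) (HQ : IsHullOrder q hQ)
    {L : List (Fin n)} (hLP : IsInterval hP L) (hLQ : IsInterval hQ L) {z : Fin n}
    (H : HasCompatibleFrom p q {y | y ∉ L.tail.dropLast} z) :
    HasCompatibleFrom p q Set.univ z := by
  obtain ⟨τ, hτ, hhead⟩ := H
  obtain ⟨B, hB⟩ := exists_isGreedy hP hQ z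
  obtain ⟨hB1, hB2, hB3, hB4⟩ := hB.1.grows
  by_cases hlen : n ≤ B.length
  · exact ⟨B, isCompatible_of_grows HP HQ hB1 hB2 hB3 hlen, hB4⟩
  exfalso
  have hstuck : Stuck hP hQ B := hB.2
  have hLB : ∀ w ∈ L, w ∈ B → L ⊆ B := fun w hw hwB =>
    hstuck.subset_of_isInterval hLP hLQ hw hwB
  have hall : ∀ w, w ∉ L.tail.dropLast → w ∈ τ := fun w hw => (hτ.mem_iff w).2 hw
  -- If `B` contained every remaining label, it would contain an end of `L`, hence all of `L`, hence
  -- every label.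
  obtain ⟨l₁, y, l₂, rfl, hl₁, hy⟩ := exists_first_not (· ∈ B) τ (by
    by_contra hcon
    push Not at hcon
    obtain ⟨w, hw⟩ := exists_not_mem_of_length_lt (not_le.1 hlen)
    by_cases hwi : w ∈ L.tail.dropLast
    · have hwL : w ∈ L := List.mem_of_mem_tail (List.dropLast_subset _ hwi)
      obtain ⟨f, hf, hfi⟩ := exists_mem_not_mem_interior hLP.1 hwL
      exact hw (hLB f hf (hcon f (hall f hfi)) hwL)
    · exact hw (hcon w (hall w hwi)))
  have hzB : z ∈ B := List.mem_of_mem_head? hB4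
  have hne : l₁ ≠ [] := by
    rintro rfl
    simp at hhead
    exact hy (hhead ▸ hzB)
  have hyi : y ∉ L.tail.dropLast := (hτ.mem_iff y).1 (by simp)
  have sep : ∀ {h : Equiv.Perm (Fin n)} {r : Fin n → Plane}, IsHullOrder r h →
      IsNoncrossing r (l₁ ++ y :: l₂) → Separated h (l₁ ++ [y]) l₂ := fun Hr hr =>
    (isNoncrossing_iff_separated Hr hτ.nodup).1 hr _ _ (by simp)
  obtain ⟨u, hu, hu'⟩ := (sep HP hτ.noncrossing_left).exists_adj_of_delete hLP hyi hne hy hl₁ hLB hall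
  obtain ⟨v, hv, hv'⟩ := (sep HQ hτ.noncrossing_right).exists_adj_of_delete hLQ hyi hne hy hl₁ hLB hall
  exact hy (hstuck.mem (hl₁ u hu) (hl₁ v hv) hu' hv')

theorem greedy_construction {n : ℕ} {p q : Fin n → Plane} {hP hQ : Equiv.Perm (Fin n)}
    (HP : IsHullOrder p hP) (HQ : IsHullOrder q hQ) {x : Fin n} {σ : List (Fin n)}
    (hσ : IsGreedy hP hQ x σ) :
    (HasCompatibleFrom p q Set.univ x ↔ σ.length = n) ∧
    (σ.length = n → IsCompatible p q Set.univ σ) ∧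
    (σ.length < n → ∀ y ∈ σ, ¬ HasCompatibleFrom p q Set.univ y) ∧
    (σ.length < n → (∃ τ : List (Fin n), IsCompatible p q Set.univ τ) →
      ∃ L : List (Fin n), L.Perm σ ∧ IsInterval hP L ∧ IsInterval hQ L) ∧
    (σ.length < n → ∀ L : List (Fin n), L.Perm σ → IsInterval hP L → IsInterval hQ L →
      ∀ z : Fin n, z ∉ L.tail.dropLast →
        (HasCompatibleFrom p q Set.univ z ↔
          HasCompatibleFrom p q {y | y ∉ L.tail.dropLast} z)) := by
  obtain ⟨h1, h2, h3, h4⟩ := hσ.1.grows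
  have hstuck : Stuck hP hQ σ := hσ.2
  have hfull : σ.length = n → IsCompatible p q Set.univ σ := fun hl =>
    isCompatible_of_grows HP HQ h1 h2 h3 hl.ge
  refine ⟨⟨fun hx => ?_, fun hl => ⟨σ, hfull hl, h4⟩⟩, hfull,
    fun hl y hy => hstuck.not_hasCompatibleFrom HP HQ hl hy,
    fun hl hex => hstuck.exists_isInterval HP HQ hl h1 h2 h3 hex,
    fun _ L _ hLP hLQ z hz => ⟨fun H => H.restrict HP HQ hz, fun H =>
      H.extend_interval HP HQ hLP hLQ⟩⟩
  by_contra hne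
  exact hstuck.not_hasCompatibleFrom HP HQ (lt_of_le_of_ne (length_le_of_nodup h1) hne)
    (List.mem_of_mem_head? h4) hx

/-! ### The two ends of an interval -/

/-- The permutation that maps each label to the next one along the hull. -/
def nextPerm {n : ℕ} (h : Equiv.Perm (Fin n)) : Equiv.Perm (Fin n) :=
  (h.symm.trans (finRotate n)).trans h

theorem nextPerm_apply {n : ℕ} (h : Equiv.Perm (Fin n)) (y : Fin n) : nextPerm h y = next h y :=
  rfl

theorem pos_iterate_next {n : ℕ} (h : Equiv.Perm (Fin n)) (y : Fin n) (k : ℕ) :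
    pos h ((next h)^[k] y) = (pos h y + k) % n := by
  induction k with
  | zero => simp [Nat.mod_eq_of_lt (pos_lt h y)]
  | succ k ih =>
    rw [Function.iterate_succ_apply', pos_next, ih, ← add_assoc, Nat.add_mod (pos h y + k) 1]
    have hn : 0 < n := (Nat.zero_le _).trans_lt (pos_lt h y)
    have hlt := Nat.mod_lt (pos h y + k) hn
    rcases Nat.lt_or_ge 1 n with h1 | h1
    · rw [Nat.mod_eq_of_lt h1]
      split_ifs with h2
      · rw [h2, Nat.mod_self]
      · rw [Nat.mod_eq_of_lt (show (pos h y + k) % n + 1 < n by omega)]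
    · have : n = 1 := by omega
      subst this
      simp [Nat.mod_one]

/-- Every nonempty set that is closed under `f` contains all labels. -/
def IsCyclicPerm {n : ℕ} (f : Equiv.Perm (Fin n)) : Prop :=
  ∀ S : Fin n → Prop, (∃ y, S y) → (∀ y, S y → S (f y)) → ∀ y, S y

theorem isCyclicPerm_nextPerm {n : ℕ} (h : Equiv.Perm (Fin n)) : IsCyclicPerm (nextPerm h) := by
  rintro S ⟨y, hy⟩ hS w
  have hit : ∀ k, S ((next h)^[k] y) := by
    intro k
    induction k with
    | zero => exact hy
    | succ k ih => rw [Function.iterate_succ_apply']; exact hS _ ih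
  have hw : (next h)^[pos h w + (n - pos h y)] y = w := by
    have h1 := pos_lt h y
    rw [← pos_inj (h := h), pos_iterate_next,
      show pos h y + (pos h w + (n - pos h y)) = pos h w + n by omega, Nat.add_mod_right,
      Nat.mod_eq_of_lt (pos_lt h w)]
  exact hw ▸ hit _

theorem IsCyclicPerm.symm {n : ℕ} {f : Equiv.Perm (Fin n)} (hf : IsCyclicPerm f) :
    IsCyclicPerm f.symm := by
  intro S hne hS w
  by_contra hw
  obtain ⟨y, hy⟩ := hne
  exact hf (fun y => ¬ S y) ⟨w, hw⟩ (fun y hy hfy => hy (by simpa using hS _ hfy)) y hy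

/-- If labels are missing from `l`, then `a` is the only one just before and `b` the only one just
after a label of `l`, with respect to `f`. -/
def Ends {n : ℕ} (f : Equiv.Perm (Fin n)) (l : List (Fin n)) (a b : Fin n) : Prop :=
  (∃ w, w ∉ l) → a ∉ l ∧ b ∉ l ∧ (∀ y, y ∉ l → (f y ∈ l ↔ y = a)) ∧
    ∀ y, y ∉ l → (f.symm y ∈ l ↔ y = b)

theorem Ends.symm {n : ℕ} {f : Equiv.Perm (Fin n)} {l : List (Fin n)} {a b : Fin n}
    (H : Ends f l a b) : Ends f.symm l b a := fun hw =>
  ⟨(H hw).2.1, (H hw).1, (H hw).2.2.2, (H hw).2.2.1⟩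

theorem ends_singleton {n : ℕ} {f : Equiv.Perm (Fin n)} (hf : IsCyclicPerm f) (x : Fin n) :
    Ends f [x] (f.symm x) (f x) := by
  rintro ⟨w, hw⟩
  simp only [List.mem_singleton] at hw ⊢
  have hne : f x ≠ x := fun e => hw (hf (· = x) ⟨x, rfl⟩ (by rintro _ rfl; exact e) w)
  refine ⟨fun e => hne ?_, hne, fun y _ => ?_, fun y _ => ?_⟩
  · rw [Equiv.symm_apply_eq] at e
    exact e.symm
  · rw [Equiv.eq_symm_apply]
  · rw [Equiv.symm_apply_eq]

/-- The new end is the predecessor of `a`; the end on the other side is unaffected because labels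
are still missing. -/
theorem Ends.append_left {n : ℕ} {f : Equiv.Perm (Fin n)} (hf : IsCyclicPerm f)
    {l : List (Fin n)} {a b : Fin n} (H : Ends f l a b) : Ends f (l ++ [a]) (f.symm a) b := by
  rintro ⟨w, hw⟩
  obtain ⟨ha, hb, h1, h2⟩ := H ⟨w, fun h => hw (by simp [h])⟩
  -- If the two ends coincided, adding `a` would close the set under `f`, so nothing would be
  -- missing.
  have hab : a ≠ b := by
    rintro rfl
    refine hw (hf (· ∈ l ++ [a]) ⟨a, by simp⟩ (fun y hy => ?_) w)
    simp only [List.mem_append, List.mem_singleton] at hy ⊢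
    rcases hy with hy | rfl
    · by_contra hcon
      push Not at hcon
      exact hcon.2 ((h2 _ hcon.1).1 (by simpa using hy))
    · exact Or.inl ((h1 _ ha).2 rfl)
  refine ⟨fun hmem => ?_, by simpa using ⟨hb, hab.symm⟩, fun y hy => ?_, fun y hy => ?_⟩
  · simp only [List.mem_append, List.mem_singleton] at hmem
    rcases hmem with hmem | hmem
    · exact hab ((h2 a ha).1 hmem)
    · rw [Equiv.symm_apply_eq] at hmem
      exact ha (hmem ▸ (h1 a ha).2 rfl)
  · simp only [List.mem_append, List.mem_singleton, not_or] at hy ⊢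
    rw [Equiv.eq_symm_apply]
    exact ⟨fun h => h.resolve_left fun h => hy.2 ((h1 y hy.1).1 h), Or.inr⟩
  · simp only [List.mem_append, List.mem_singleton, not_or] at hy ⊢
    rw [h2 y hy.1]
    refine ⟨fun h => h.resolve_right fun h => hy.1 ?_, Or.inl⟩
    rw [Equiv.symm_apply_eq] at h
    exact h ▸ (h1 a ha).2 rfl

theorem Ends.append_right {n : ℕ} {f : Equiv.Perm (Fin n)} (hf : IsCyclicPerm f)
    {l : List (Fin n)} {a b : Fin n} (H : Ends f l a b) : Ends f (l ++ [b]) a (f b) := by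
  simpa using (H.symm.append_left hf.symm).symm

theorem Ends.outerLabels_eq {n : ℕ} {h : Equiv.Perm (Fin n)} {l : List (Fin n)} {a b : Fin n}
    (H : Ends (nextPerm h) l a b) (hl : ∃ w, w ∉ l) : outerLabels h l = {a, b} := by
  obtain ⟨ha, hb, h1, h2⟩ := H hl
  have h3 : ∀ y, (∃ z ∈ l, next h z = y) ↔ (nextPerm h).symm y ∈ l := by
    intro y
    constructor
    · rintro ⟨z, hz, rfl⟩
      rwa [← nextPerm_apply, Equiv.symm_apply_apply]
    · intro hy
      exact ⟨_, hy, by rw [← nextPerm_apply, Equiv.apply_symm_apply]⟩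
  ext y
  simp only [outerLabels, Set.mem_ofPred_eq, Set.mem_insert_iff, Set.mem_singleton_iff, h3]
  by_cases hy : y ∈ l
  · simp only [hy, not_true, false_and, false_iff, not_or]
    exact ⟨fun e => ha (e ▸ hy), fun e => hb (e ▸ hy)⟩
  · simp only [hy, not_false_eq_true, true_and]
    rw [h2 y hy, ← nextPerm_apply, h1 y hy]

/-! ### Sweeping over dead ends -/

/-- A sequence in which the greedy construction stops too early. -/
structure IsDeadEnd {n : ℕ} (hP hQ : Equiv.Perm (Fin n)) (l : List (Fin n)) : Prop where
  nodup : l.Nodup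
  grows_left : Grows hP l
  grows_right : Grows hQ l
  stuck : Stuck hP hQ l
  length_lt : l.length < n

/-- The labels of `l` form a common interval, which the stuck set `l'` contains as soon as it meets
it. -/
theorem IsDeadEnd.subset {n : ℕ} {p q : Fin n → Plane} {hP hQ : Equiv.Perm (Fin n)}
    (HP : IsHullOrder p hP) (HQ : IsHullOrder q hQ)
    (hex : ∃ τ : List (Fin n), IsCompatible p q Set.univ τ) {l l' : List (Fin n)}
    (hl : IsDeadEnd hP hQ l) (hl' : IsDeadEnd hP hQ l') {y : Fin n} (hy : y ∈ l) (hy' : y ∈ l') :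
    l ⊆ l' := by
  obtain ⟨L, hL, hLP, hLQ⟩ := hl.stuck.exists_isInterval HP HQ hl.length_lt hl.nodup hl.grows_left
    hl.grows_right hex
  exact fun w hw => hl'.stuck.subset_of_isInterval hLP hLQ (hL.mem_iff.2 hy) hy' (hL.mem_iff.2 hw)

/-- There are `m` labels that lie in dead ends, and `x` is the next label after them. -/
def Sweep {n : ℕ} (hP hQ : Equiv.Perm (Fin n)) (m : ℕ) (x : Fin n) : Prop :=
  ∃ U : List (Fin n), U.Nodup ∧ U.length = m ∧ (∀ y ∈ U, next hP y ∈ U ∨ next hP y = x) ∧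
    ∀ y ∈ U, ∃ l, IsDeadEnd hP hQ l ∧ y ∈ l ∧ l ⊆ U

theorem sweep_zero {n : ℕ} (hP hQ : Equiv.Perm (Fin n)) (x : Fin n) : Sweep hP hQ 0 x :=
  ⟨[], by simp⟩

theorem Sweep.step {n : ℕ} {p q : Fin n → Plane} {hP hQ : Equiv.Perm (Fin n)}
    (HP : IsHullOrder p hP) (HQ : IsHullOrder q hQ)
    (hex : ∃ τ : List (Fin n), IsCompatible p q Set.univ τ) {m : ℕ} {x a b : Fin n}
    (H : Sweep hP hQ m x) (hm : m < n) {l : List (Fin n)} (hl : IsDeadEnd hP hQ l)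
    (hx : l.head? = some x) (hends : Ends (nextPerm hP) l a b) :
    Sweep hP hQ (m + l.length) b := by
  obtain ⟨U, hU, rfl, hnext, hdead⟩ := H
  have hxl : x ∈ l := List.mem_of_mem_head? hx
  -- Otherwise `U` would be closed under `next hP` and contain all labels, although `m < n`.
  have hxU : x ∉ U := by
    intro hxU
    obtain ⟨w, hw⟩ := exists_not_mem_of_length_lt hm
    exact hw (isCyclicPerm_nextPerm hP (· ∈ U) ⟨x, hxU⟩
      (fun y hy => (hnext y hy).elim id fun e => by rw [nextPerm_apply, e]; exact hxU) w)
  obtain ⟨-, -, -, h2⟩ := hends (exists_not_mem_of_length_lt hl.length_lt)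
  refine ⟨U ++ l, List.nodup_append.2 ⟨hU, hl.nodup, ?_⟩, by simp, ?_, ?_⟩
  -- A common label would put `l` inside a dead end contained in `U`, and so `x` into `U`.
  · rintro y hyU _ hyl rfl
    obtain ⟨l', hl', hy', hl'U⟩ := hdead y hyU
    exact hxU (hl'U (hl.subset HP HQ hex hl' hyl hy' hxl))
  · intro y hy
    simp only [List.mem_append] at hy ⊢
    rcases hy with hy | hy
    · rcases hnext y hy with h | h
      · exact Or.inl (Or.inl h)
      · exact Or.inl (Or.inr (h ▸ hxl))
    · by_cases hyl : next hP y ∈ l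
      · exact Or.inl (Or.inr hyl)
      · exact Or.inr ((h2 _ hyl).1 (by rwa [← nextPerm_apply, Equiv.symm_apply_apply]))
  · intro y hy
    rcases List.mem_append.1 hy with hy | hy
    · obtain ⟨l', hl', hy', hl'U⟩ := hdead y hy
      exact ⟨l', hl', hy', fun w hw => List.mem_append_left _ (hl'U hw)⟩
    · exact ⟨l, hl, hy, fun w hw => List.mem_append_right _ hw⟩

theorem Sweep.not_exists {n : ℕ} {p q : Fin n → Plane} {hP hQ : Equiv.Perm (Fin n)}
    (HP : IsHullOrder p hP) (HQ : IsHullOrder q hQ) {m : ℕ} {x : Fin n}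
    (H : (∃ τ : List (Fin n), IsCompatible p q Set.univ τ) → Sweep hP hQ m x) (hm : n ≤ m) :
    ¬ ∃ τ : List (Fin n), IsCompatible p q Set.univ τ := by
  intro hex
  obtain ⟨U, hU, rfl, -, hdead⟩ := H hex
  obtain ⟨τ, hτ⟩ := hex
  cases τ with
  | nil => simpa using (hτ.mem_iff x).2 trivial
  | cons z τ =>
    obtain ⟨l, hl, hz, -⟩ := hdead z (mem_of_nodup_of_le_length hU hm z)
    exact hl.stuck.not_hasCompatibleFrom HP HQ hl.length_lt hz ⟨_, hτ, rfl⟩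

/-! ### Reasoning about programs -/

/-- `c` halts when started in `s`, after at most `T` steps and in a state that satisfies `Q`. -/
def Halts (W : ℕ) (c : Prog) (s : State) (T : ℕ) (Q : State → Prop) : Prop :=
  ∃ t s', t ≤ T ∧ Runs W c s t s' ∧ Q s'

theorem Halts.mono {W : ℕ} {c : Prog} {s : State} {T T' : ℕ} {Q Q' : State → Prop}
    (H : Halts W c s T Q) (hT : T ≤ T') (hQ : ∀ s', Q s' → Q' s') : Halts W c s T' Q' := by
  obtain ⟨t, s', ht, hr, hq⟩ := H
  exact ⟨t, s', ht.trans hT, hr, hQ s' hq⟩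

theorem Halts.seq {W : ℕ} {c d : Prog} {s : State} {T₁ T₂ : ℕ} {R Q : State → Prop}
    (H : Halts W c s T₁ R) (H' : ∀ s', R s' → Halts W d s' T₂ Q) :
    Halts W (.seq c d) s (T₁ + T₂) Q := by
  obtain ⟨t, s', ht, hr, hq⟩ := H
  obtain ⟨t', s'', ht', hr', hq'⟩ := H' s' hq
  exact ⟨t + t', s'', by omega, .seq _ _ _ _ _ _ _ hr hr', hq'⟩

theorem Halts.ite {W : ℕ} {b : Test} {c d : Prog} {s : State} {T : ℕ} {Q : State → Prop}
    (H : b.Holds s → Halts W c s T Q) (H' : ¬ b.Holds s → Halts W d s T Q) :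
    Halts W (.ite b c d) s (T + 1) Q := by
  by_cases hb : b.Holds s
  · obtain ⟨t, s', ht, hr, hq⟩ := H hb
    exact ⟨t + 1, s', by omega, .ite_true _ _ _ _ _ _ hb hr, hq⟩
  · obtain ⟨t, s', ht, hr, hq⟩ := H' hb
    exact ⟨t + 1, s', by omega, .ite_false _ _ _ _ _ _ hb hr, hq⟩

/-- Loops: `μ` decreases, and `κ` pays for the steps. -/
theorem Halts.loop {W : ℕ} {b : Test} {c : Prog} {I : State → Prop} (μ κ : State → ℕ)
    (H : ∀ s, I s → b.Holds s → ∃ t s', Runs W c s t s' ∧ I s' ∧ μ s' < μ s ∧ t + 1 + κ s ≤ κ s')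
    (s : State) (hs : I s) :
    ∃ t s', Runs W (.loop b c) s t s' ∧ I s' ∧ ¬ b.Holds s' ∧ t + κ s ≤ κ s' + 1 := by
  induction hm : μ s using Nat.strong_induction_on generalizing s with
  | _ m ih =>
    by_cases hb : b.Holds s
    · obtain ⟨t, s', hr, hI, hlt, ht⟩ := H s hs hb
      obtain ⟨t', s'', hr', hI', hb', ht'⟩ := ih (μ s') (hm ▸ hlt) s' hI rfl
      exact ⟨t + t' + 1, s'', .loop_true _ _ _ _ _ _ _ hb hr hr', hI', hb', by omega⟩
    · exact ⟨1, s, .loop_false _ _ _ hb, hs, hb, by omega⟩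

/-- A sequence of instructions. -/
def block : List Instr → Prog
  | [] => .skip
  | i :: is => .seq (.instr i) (block is)

/-- The state after a sequence of instructions. -/
def exec (s : State) : List Instr → State
  | [] => s
  | i :: is => exec (i.result s) is

/-- All words written by a sequence of instructions are at most `W`. -/
def Fits (W : ℕ) (s : State) : List Instr → Prop
  | [] => True
  | i :: is => i.value s ≤ W ∧ Fits W (i.result s) is

theorem runs_block {W : ℕ} : ∀ (is : List Instr) (s : State), Fits W s is →
    Runs W (block is) s (is.length + 1) (exec s is)
  | [], s, _ => .skip s
  | i :: is, s, h => by
    have := Runs.seq _ _ _ _ _ _ _ (Runs.instr i s h.1) (runs_block is _ h.2)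
    rwa [add_comm] at this

theorem halts_block {W : ℕ} {is : List Instr} {s : State} {Q : State → Prop} (h : Fits W s is)
    (hQ : Q (exec s is)) : Halts W (block is) s (is.length + 1) Q :=
  ⟨_, _, le_rfl, runs_block is s h, hQ⟩

/-! ### The tables of neighbours -/

/-- Fills the tables of next and previous labels at the addresses in registers `rn` and `rp`. -/
def fillTables (rn rp : ℕ) : Prog :=
  .loop (.lt 16 17) (block [.load 19 16, .add 15 rn 18, .store 15 19, .add 15 rp 19, .store 15 18,
    .copy 18 19, .add 16 16 1])

/-- Register 16 scans the hull list and register 18 holds the label just before the scanned one;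
initially this is the last label of the list, which closes the cycle. A round costs 9 steps: seven
instructions, the closing `skip` and the test. -/
theorem halts_fillTables {n W rn rp st dn : ℕ} (h : Equiv.Perm (Fin n)) (s : State)
    (hrn : rn < 15) (hrp : rp < 15) (h1 : s.reg 1 = 1) (hdn : s.reg rn = dn)
    (hdp : s.reg rp = dn + n) (hst : s.reg 16 = st) (hend : s.reg 17 = st + n) (hle : st + n ≤ dn)
    (hmem : ∀ i : Fin n, s.mem (st + i) = h i)
    (hlast : ∀ y, pos h (next h y) = 0 → s.reg 18 = y) (hW : dn + n + n ≤ W) :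
    Halts W (fillTables rn rp) s (9 * n + 1) fun s' =>
      (∀ r, r < 15 ∨ 19 < r → s'.reg r = s.reg r) ∧
      (∀ y : Fin n, s'.mem (dn + y) = next h y ∧ s'.mem (dn + n + next h y) = y) ∧
      ∀ a, a < dn ∨ dn + n + n ≤ a → s'.mem a = s.mem a := by
  let I : State → Prop := fun s' =>
    (∀ r, r < 15 ∨ 19 < r → s'.reg r = s.reg r) ∧ s'.reg 17 = st + n ∧
    (∀ a, a < dn ∨ dn + n + n ≤ a → s'.mem a = s.mem a) ∧
    ∃ i, i ≤ n ∧ s'.reg 16 = st + i ∧ (∀ y, pos h (next h y) = i → s'.reg 18 = y) ∧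
      ∀ y : Fin n, pos h (next h y) < i → s'.mem (dn + y) = next h y ∧
        s'.mem (dn + n + next h y) = y
  obtain ⟨t, s', hr, ⟨hreg, h17, hfr, i, hi, h16, -, htab⟩, hb, ht⟩ :=
    Halts.loop (W := W) (b := .lt 16 17) (I := I) (fun s' => st + n - s'.reg 16)
      (fun s' => 9 * (s'.reg 16 - st))
      (c := block [.load 19 16, .add 15 rn 18, .store 15 19, .add 15 rp 19, .store 15 18,
        .copy 18 19, .add 16 16 1]) (by
    rintro s' ⟨hreg, h17, hfr, i, hi, h16, hu, htab⟩ hb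
    simp only [Test.Holds, h16, h17] at hb
    have hin : i < n := by omega
    have hv : s'.mem (st + i) = h ⟨i, hin⟩ := by
      rw [hfr _ (by omega)]
      exact hmem ⟨i, hin⟩
    obtain ⟨u, hu'⟩ := exists_next_eq h (h ⟨i, hin⟩)
    have hposu : pos h (next h u) = i := by simp [hu', pos]
    have h18 := hu u hposu
    have e1 : s'.reg 1 = 1 := (hreg 1 (by omega)).trans h1
    have ern : s'.reg rn = dn := (hreg rn (by omega)).trans hdn
    have erp : s'.reg rp = dn + n := (hreg rp (by omega)).trans hdp
    have hun := u.2
    have hvn := (h ⟨i, hin⟩).2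
    have k2 : rn ≠ 19 := by omega
    have k3 : rp ≠ 15 := by omega
    have k4 : rp ≠ 19 := by omega
    refine ⟨_, _, runs_block _ _ ?_, ?_⟩
    · simp [Fits, Instr.value, Instr.result, h16, hv, h18, e1, ern, erp, k2, k3, k4]
      omega
    · simp [exec, Instr.result, Function.update_apply, h16, hv, h18, e1, ern, erp, k2, k3, k4,
        I, h17]
      refine ⟨⟨?_, ?_, i + 1, by omega, by omega, ?_, ?_⟩, by omega, by omega⟩
      · intro r hr
        rw [if_neg (by omega), if_neg (by omega), if_neg (by omega), if_neg (by omega)]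
        exact hreg r hr
      · intro a ha
        rw [if_neg (by omega), if_neg (by omega)]
        exact hfr a ha
      · intro y hy
        have := pos_next h y
        have hy' : pos h y = i := by
          split_ifs at this <;> omega
        subst hy'
        simp [pos]
      · intro y hy
        have hyn := y.2
        have hnn := (next h y).2
        by_cases hyu : y = u
        · subst hyu
          rw [if_neg (by omega), if_pos (by omega), if_pos (by rw [hu'])]
          simp [hu']
        · have hne : (y : ℕ) ≠ u := fun e => hyu (Fin.ext e)
          have hne' : next h y ≠ h ⟨i, hin⟩ := fun e => hyu (next_injective h (e.trans hu'.symm))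
          have hne'' : (next h y : ℕ) ≠ h ⟨i, hin⟩ := fun e => hne' (Fin.ext e)
          have hlt : pos h (next h y) < i := by
            rcases Nat.lt_succ_iff_lt_or_eq.1 hy with h | h
            · exact h
            · exact absurd (pos_inj.1 (h.trans hposu.symm)) (fun e => hyu (next_injective _ e))
          rw [if_neg (by omega), if_neg (by omega), if_neg (by omega), if_neg (by omega)]
          exact htab y hlt) s ⟨fun _ _ => rfl, hend, fun _ _ => rfl, 0, by omega, by omega, hlast,
            by simp⟩
  refine ⟨t, s', ?_, hr, hreg, fun y => htab y ?_, hfr⟩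
  · simp only [h16, hst] at ht
    omega
  · simp only [Test.Holds, h16, h17] at hb
    have := pos_lt h (next h y)
    omega

/-! ### The greedy search -/

/-- The constants `1, 2n, 3n, 4n, 5n` are in their registers and the tables of neighbours in
memory. -/
structure Tables {n : ℕ} (hP hQ : Equiv.Perm (Fin n)) (s : State) : Prop where
  reg_zero : s.reg 0 = n
  reg_one : s.reg 1 = 1
  reg_two : s.reg 2 = 2 * n
  reg_three : s.reg 3 = 3 * n
  reg_four : s.reg 4 = 4 * n
  reg_five : s.reg 5 = 5 * n
  reg_twenty : s.reg 20 = 0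
  next_left : ∀ y : Fin n, s.mem (2 * n + y) = nextPerm hP y
  prev_left : ∀ y : Fin n, s.mem (3 * n + y) = (nextPerm hP).symm y
  next_right : ∀ y : Fin n, s.mem (4 * n + y) = nextPerm hQ y
  prev_right : ∀ y : Fin n, s.mem (5 * n + y) = (nextPerm hQ).symm y

/-- The output overwrites the input cells, so only memory from `2 * n` on has to be preserved. -/
theorem Tables.congr {n : ℕ} {hP hQ : Equiv.Perm (Fin n)} {s s' : State} (H : Tables hP hQ s)
    (h1 : ∀ r, r < 6 ∨ r = 20 → s'.reg r = s.reg r) (h2 : ∀ a, 2 * n ≤ a → s'.mem a = s.mem a) :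
    Tables hP hQ s' where
  reg_zero := (h1 0 (by omega)).trans H.reg_zero
  reg_one := (h1 1 (by omega)).trans H.reg_one
  reg_two := (h1 2 (by omega)).trans H.reg_two
  reg_three := (h1 3 (by omega)).trans H.reg_three
  reg_four := (h1 4 (by omega)).trans H.reg_four
  reg_five := (h1 5 (by omega)).trans H.reg_five
  reg_twenty := (h1 20 (by omega)).trans H.reg_twenty
  next_left y := (h2 _ (by omega)).trans (H.next_left y)
  prev_left y := (h2 _ (by omega)).trans (H.prev_left y)
  next_right y := (h2 _ (by omega)).trans (H.next_right y)
  prev_right y := (h2 _ (by omega)).trans (H.prev_right y)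

/-- The greedy construction from `x` has reached `l`, which is written to memory, with the labels
`a, b` and `c, d` at the ends. Registers 12 and 14 hold `m` and `r`. -/
structure Search {n : ℕ} (hP hQ : Equiv.Perm (Fin n)) (x : Fin n) (m r : ℕ) (s : State)
    (l : List (Fin n)) (a b c d : Fin n) : Prop where
  tables : Tables hP hQ s
  reg_start : s.reg 6 = x
  reg_count : s.reg 12 = m
  reg_result : s.reg 14 = r
  reg_a : s.reg 7 = a
  reg_b : s.reg 8 = b
  reg_c : s.reg 9 = c
  reg_d : s.reg 10 = d
  reg_length : s.reg 11 = l.length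
  out : ∀ (i : ℕ) (hi : i < l.length), s.mem i = l[i]
  nodup : l.Nodup
  grows_left : Grows hP l
  grows_right : Grows hQ l
  head : l.head? = some x
  ends_left : Ends (nextPerm hP) l a b
  ends_right : Ends (nextPerm hQ) l c d

theorem Search.append {n : ℕ} {hP hQ : Equiv.Perm (Fin n)} {x : Fin n} {m r : ℕ} {s s' : State}
    {l : List (Fin n)} {a b c d a' b' c' d' y : Fin n} (H : Search hP hQ x m r s l a b c d)
    (hl : l.length < n) (hy : y ∈ outerLabels hP l ∩ outerLabels hQ l)
    (hreg : ∀ r, r < 7 ∨ r = 12 ∨ r = 14 ∨ r = 20 → s'.reg r = s.reg r)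
    (ha : s'.reg 7 = a') (hb : s'.reg 8 = b') (hc : s'.reg 9 = c') (hd : s'.reg 10 = d')
    (hk : s'.reg 11 = l.length + 1) (hmem : s'.mem = Function.update s.mem l.length y)
    (hE : Ends (nextPerm hP) (l ++ [y]) a' b') (hE' : Ends (nextPerm hQ) (l ++ [y]) c' d') :
    Search hP hQ x m r s' (l ++ [y]) a' b' c' d' where
  tables := H.tables.congr (fun r hr => hreg r (by omega)) fun a ha => by
    rw [hmem, Function.update_of_ne (by omega)]
  reg_start := (hreg 6 (by omega)).trans H.reg_start
  reg_count := (hreg 12 (by omega)).trans H.reg_count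
  reg_result := (hreg 14 (by omega)).trans H.reg_result
  reg_a := ha
  reg_b := hb
  reg_c := hc
  reg_d := hd
  reg_length := by simpa using hk
  out i hi := by
    rw [hmem]
    rcases Nat.lt_or_ge i l.length with h | h
    · rw [Function.update_of_ne (by omega), List.getElem_append_left h]
      exact H.out i h
    · have : i = l.length := by simp at hi; omega
      subst this
      simp
  nodup := by
    rw [List.nodup_append]
    refine ⟨H.nodup, by simp, ?_⟩
    rintro u hu v hv rfl
    rw [List.mem_singleton.1 hv] at hu
    exact (mem_outerLabels_iff.1 hy.1).1 hu
  grows_left := H.grows_left.append fun w hw => by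
    rw [List.mem_singleton.1 hw]
    exact (mem_outerLabels_iff.1 hy.1).2
  grows_right := H.grows_right.append fun w hw => by
    rw [List.mem_singleton.1 hw]
    exact (mem_outerLabels_iff.1 hy.2).2
  head := by
    rw [List.head?_append, H.head]
    rfl
  ends_left := hE
  ends_right := hE'

/-- Appends the label in register `ra`, which is also in register `rc`, and moves on to the
neighbours according to the tables at the addresses in registers `ba` and `bc`. -/
def extendBy (ra ba rc bc : ℕ) : List Instr :=
  [.store 11 ra, .add 11 11 1, .add 15 ba ra, .load ra 15, .add 15 bc rc, .load rc 15]

/-- One step of the greedy construction; register 13 is set to `0` if there is none. -/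
def greedyStep : Prog :=
  -- The ends just before the set (registers 7 and 9) move by the tables of previous labels (3 and
  -- 5), those just after (8 and 10) by the tables of next labels (2 and 4).
  .ite (.eq 7 9) (block (extendBy 7 3 9 5)) <| .ite (.eq 7 10) (block (extendBy 7 3 10 4)) <|
    .ite (.eq 8 9) (block (extendBy 8 2 9 5)) <| .ite (.eq 8 10) (block (extendBy 8 2 10 4)) <|
      .instr (.const 13 0)

/-- The program appends one label at a time, unlike `GreedyStage`. This is harmless: correctness
rests only on growth on both hulls and on the final set being stuck or complete. -/
theorem halts_greedyStep {n W : ℕ} {hP hQ : Equiv.Perm (Fin n)} {x : Fin n} {m r : ℕ} {s : State}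
    {l : List (Fin n)} {a b c d : Fin n} (hW : 6 * n ≤ W) (H : Search hP hQ x m r s l a b c d)
    (hl : l.length < n) (hg : s.reg 13 = n) :
    Halts W greedyStep s 15 fun s' =>
      (∃ l' a' b' c' d', Search hP hQ x m r s' l' a' b' c' d' ∧ l'.length = l.length + 1 ∧
        s'.reg 13 = n) ∨
      (Search hP hQ x m r s' l a b c d ∧ Stuck hP hQ l ∧ s'.reg 13 = 0) := by
  have hw : ∃ w, w ∉ l := exists_not_mem_of_length_lt hl
  have hoP := H.ends_left.outerLabels_eq hw
  have hoQ := H.ends_right.outerLabels_eq hw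
  have hcP := isCyclicPerm_nextPerm hP
  have hcQ := isCyclicPerm_nextPerm hQ
  have han := a.2
  have hbn := b.2
  have hcn := c.2
  have hdn := d.2
  have f2 := H.tables.reg_two
  have f3 := H.tables.reg_three
  have f4 := H.tables.reg_four
  have f5 := H.tables.reg_five
  have ne2 : ∀ y, 2 * n + y ≠ l.length := fun y => by omega
  have ne3 : ∀ y, 3 * n + y ≠ l.length := fun y => by omega
  have ne4 : ∀ y, 4 * n + y ≠ l.length := fun y => by omega
  have ne5 : ∀ y, 5 * n + y ≠ l.length := fun y => by omega
  have hreg : ∀ {ra ba rc bc}, 7 ≤ ra → ra ≤ 10 → 7 ≤ rc → rc ≤ 10 →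
      ∀ r, r < 7 ∨ r = 12 ∨ r = 14 ∨ r = 20 →
        (exec s (extendBy ra ba rc bc)).reg r = s.reg r := by
    intro ra ba rc bc h1 h2 h3 h4 r hr
    simp only [extendBy, exec, Instr.result]
    rw [Function.update_of_ne (by omega), Function.update_of_ne (by omega),
      Function.update_of_ne (by omega), Function.update_of_ne (by omega),
      Function.update_of_ne (by omega)]
  have pa := ((nextPerm hP).symm a).2
  have nb := (nextPerm hP b).2
  have pc := ((nextPerm hQ).symm c).2
  have nd := (nextPerm hQ d).2
  unfold greedyStep
  refine (Halts.ite (T := 11) (fun h => ?_) fun h1 => Halts.ite (T := 10) (fun h => ?_) fun h2 =>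
    Halts.ite (T := 9) (fun h => ?_) fun h3 => Halts.ite (T := 8) (fun h => ?_) fun h4 => ?_).mono
    (by omega) fun _ hq => hq
  · simp only [Test.Holds, H.reg_a, H.reg_c] at h
    have hac : a = c := Fin.ext h
    subst hac
    refine (halts_block ?_ ?_).mono (by simp [extendBy]) fun _ hq => hq
    · simp [extendBy, Fits, Instr.value, Instr.result, H.reg_a, H.reg_c, H.reg_length,
        H.tables.reg_one, f3, f5, H.tables.prev_left, H.tables.prev_right,
        ne3, ne5]
      omega
    · left
      refine ⟨l ++ [a], _, b, _, d, H.append hl (by simp [hoP, hoQ]) (hreg (by omega) (by omega)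
        (by omega) (by omega)) ?_ ?_ ?_ ?_ ?_ ?_ (H.ends_left.append_left hcP)
        (H.ends_right.append_left hcQ), by simp, ?_⟩ <;>
      simp [extendBy, exec, Instr.result, H.reg_a, H.reg_b, H.reg_c, H.reg_d, H.reg_length,
        H.tables.reg_one, f3, f5, H.tables.prev_left, H.tables.prev_right,
        ne3, ne5, hg]
  · simp only [Test.Holds, H.reg_a, H.reg_d] at h
    have hac : a = d := Fin.ext h
    subst hac
    refine (halts_block ?_ ?_).mono (by simp [extendBy]) fun _ hq => hq
    · simp [extendBy, Fits, Instr.value, Instr.result, H.reg_a, H.reg_d, H.reg_length,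
        H.tables.reg_one, f3, f4, H.tables.prev_left, H.tables.next_right,
        ne3, ne4]
      omega
    · left
      refine ⟨l ++ [a], _, b, c, _, H.append hl (by simp [hoP, hoQ]) (hreg (by omega) (by omega)
        (by omega) (by omega)) ?_ ?_ ?_ ?_ ?_ ?_ (H.ends_left.append_left hcP)
        (H.ends_right.append_right hcQ), by simp, ?_⟩ <;>
      simp [extendBy, exec, Instr.result, H.reg_a, H.reg_b, H.reg_c, H.reg_d, H.reg_length,
        H.tables.reg_one, f3, f4, H.tables.prev_left, H.tables.next_right,
        ne3, ne4, hg]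
  · simp only [Test.Holds, H.reg_b, H.reg_c] at h
    have hac : b = c := Fin.ext h
    subst hac
    refine (halts_block ?_ ?_).mono (by simp [extendBy]) fun _ hq => hq
    · simp [extendBy, Fits, Instr.value, Instr.result, H.reg_b, H.reg_c, H.reg_length,
        H.tables.reg_one, f2, f5, H.tables.next_left, H.tables.prev_right,
        ne2, ne5]
      omega
    · left
      refine ⟨l ++ [b], a, _, _, d, H.append hl (by simp [hoP, hoQ]) (hreg (by omega) (by omega)
        (by omega) (by omega)) ?_ ?_ ?_ ?_ ?_ ?_ (H.ends_left.append_right hcP)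
        (H.ends_right.append_left hcQ), by simp, ?_⟩ <;>
      simp [extendBy, exec, Instr.result, H.reg_a, H.reg_b, H.reg_c, H.reg_d, H.reg_length,
        H.tables.reg_one, f2, f5, H.tables.next_left, H.tables.prev_right,
        ne2, ne5, hg]
  · simp only [Test.Holds, H.reg_b, H.reg_d] at h
    have hac : b = d := Fin.ext h
    subst hac
    refine (halts_block ?_ ?_).mono (by simp [extendBy]) fun _ hq => hq
    · simp [extendBy, Fits, Instr.value, Instr.result, H.reg_b, H.reg_d, H.reg_length,
        H.tables.reg_one, f2, f4, H.tables.next_left, H.tables.next_right,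
        ne2, ne4]
      omega
    · left
      refine ⟨l ++ [b], a, _, c, _, H.append hl (by simp [hoP, hoQ]) (hreg (by omega) (by omega)
        (by omega) (by omega)) ?_ ?_ ?_ ?_ ?_ ?_ (H.ends_left.append_right hcP)
        (H.ends_right.append_right hcQ), by simp, ?_⟩ <;>
      simp [extendBy, exec, Instr.result, H.reg_a, H.reg_b, H.reg_c, H.reg_d, H.reg_length,
        H.tables.reg_one, f2, f4, H.tables.next_left, H.tables.next_right,
        ne2, ne4, hg]
  · simp only [Test.Holds, H.reg_a, H.reg_b, H.reg_c, H.reg_d, Fin.val_inj] at h1 h2 h3 h4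
    refine ⟨1, _, by omega, .instr _ _ (by simp [Instr.value]), Or.inr ⟨?_, ?_, ?_⟩⟩
    · obtain ⟨t, g1, g2, g3, g4, g5, g6, g7, g8, g9, g10, g11, g12, g13, g14, g15⟩ := H
      refine ⟨t.congr (fun r hr => ?_) fun _ _ => rfl, ?_, ?_, ?_, ?_, ?_, ?_, ?_, ?_, g9, g10, g11,
        g12, g13, g14, g15⟩
      · simp only [Instr.result]
        rw [Function.update_of_ne (by omega)]
      all_goals simpa [Instr.result]
    · rw [Stuck, hoP, hoQ]
      ext y
      simp only [Set.mem_inter_iff, Set.mem_insert_iff, Set.mem_singleton_iff,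
        Set.mem_empty_iff_false, iff_false]
      rintro ⟨rfl | rfl, rfl | rfl⟩ <;> simp_all
    · simp [Instr.result]

/-- The greedy construction from the label in register 6. -/
def greedyFrom : Prog :=
  .seq (block [.copy 11 20, .store 11 6, .copy 11 1, .add 15 3 6, .load 7 15, .add 15 2 6,
    .load 8 15, .add 15 5 6, .load 9 15, .add 15 4 6, .load 10 15, .copy 13 0])
    (.loop (.lt 11 13) greedyStep)

theorem halts_greedyFrom {n W : ℕ} {hP hQ : Equiv.Perm (Fin n)} {x : Fin n} {s : State}
    (hW : 6 * n ≤ W) (H : Tables hP hQ s) (hx : s.reg 6 = x) :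
    ∃ t s' l a b c d, Runs W greedyFrom s t s' ∧
      Search hP hQ x (s.reg 12) (s.reg 14) s' l a b c d ∧ t ≤ 20 * l.length + 14 ∧
      (l.length = n ∨ (l.length < n ∧ Stuck hP hQ l)) := by
  have hxn := x.2
  have hn : n ≠ 0 := by omega
  have f1 := H.reg_one
  have f2 := H.reg_two
  have f3 := H.reg_three
  have f4 := H.reg_four
  have f5 := H.reg_five
  have f20 := H.reg_twenty
  have f0 := H.reg_zero
  have pa := ((nextPerm hP).symm x).2
  have nb := (nextPerm hP x).2
  have pc := ((nextPerm hQ).symm x).2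
  have nd := (nextPerm hQ x).2
  let init : List Instr := [.copy 11 20, .store 11 6, .copy 11 1, .add 15 3 6, .load 7 15,
    .add 15 2 6, .load 8 15, .add 15 5 6, .load 9 15, .add 15 4 6, .load 10 15, .copy 13 0]
  have hfits : Fits W s init := by
    simp [init, Fits, Instr.value, Instr.result, f20, f1, f2, f3, f4, f5, f0, hx,
      hn, H.next_left, H.prev_left, H.next_right, H.prev_right]
    omega
  have h0 : Search hP hQ x (s.reg 12) (s.reg 14) (exec s init) [x] ((nextPerm hP).symm x)
      (nextPerm hP x) ((nextPerm hQ).symm x) (nextPerm hQ x) := by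
    refine ⟨H.congr (fun r hr => ?_) (fun a ha => ?_), ?_, ?_, ?_, ?_, ?_, ?_, ?_, ?_, ?_, by simp,
      grows_singleton _ _, grows_singleton _ _, rfl, ends_singleton (isCyclicPerm_nextPerm hP) x,
      ends_singleton (isCyclicPerm_nextPerm hQ) x⟩
    · have : r ≠ 11 ∧ r ≠ 15 ∧ r ≠ 7 ∧ r ≠ 8 ∧ r ≠ 9 ∧ r ≠ 10 ∧ r ≠ 13 := by omega
      simp [init, exec, Instr.result, Function.update_apply, this]
    · have : a ≠ 0 := by omega
      simp [init, exec, Instr.result, f20, Function.update_apply, this]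
    all_goals simp [init, exec, Instr.result, f20, f1, f2, f3, f4, f5, hx,
      Function.update_apply, hn, H.next_left, H.prev_left, H.next_right, H.prev_right]
  have h13 : (exec s init).reg 13 = n := by
    simp [init, exec, Instr.result, f0]
  let I : State → Prop := fun s' => ∃ l a b c d,
    Search hP hQ x (s.reg 12) (s.reg 14) s' l a b c d ∧
      (s'.reg 13 = n ∨ (s'.reg 13 = 0 ∧ l.length < n ∧ Stuck hP hQ l))
  obtain ⟨t, s', hr, ⟨l, a, b, c, d, hS, hcase⟩, hb, ht⟩ :=
    Halts.loop (W := W) (b := .lt 11 13) (c := greedyStep) (I := I)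
      (fun s => (n - s.reg 11) + s.reg 13)
      -- The extra 20 pays for the one step that finds no common label and sets register 13 to `0`,
      -- which ends the loop.
      (fun s => 20 * s.reg 11 + if s.reg 13 = 0 then 20 else 0) (by
    rintro s' ⟨l, a, b, c, d, hS, hcase⟩ hb
    simp only [Test.Holds, hS.reg_length] at hb
    have hg : s'.reg 13 = n := by omega
    have hl : l.length < n := by omega
    obtain ⟨t, s'', ht, hr, hpost⟩ := halts_greedyStep hW hS hl hg
    have h7 := hS.reg_length
    rcases hpost with ⟨l', a', b', c', d', hS', hlen, hg'⟩ | ⟨hS', hst, hg'⟩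
    · refine ⟨t, s'', hr, ⟨l', a', b', c', d', hS', Or.inl hg'⟩, ?_, ?_⟩
      · simp only [hS'.reg_length, hlen, h7, hg, hg']
        omega
      · simp only [hS'.reg_length, hlen, h7, hg, hg']
        split_ifs <;> omega
    · refine ⟨t, s'', hr, ⟨l, a, b, c, d, hS', Or.inr ⟨hg', hl, hst⟩⟩, ?_, ?_⟩
      · simp only [hS'.reg_length, h7, hg, hg']
        omega
      · simp only [hS'.reg_length, h7, hg, hg', if_true]
        split_ifs <;> omega) (exec s init) ⟨_, _, _, _, _, h0, Or.inl h13⟩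
  have hlen := length_le_of_nodup hS.nodup
  refine ⟨_, s', l, a, b, c, d, .seq _ _ _ _ _ _ _ (runs_block _ _ hfits) hr, hS, ?_, ?_⟩
  · have h11 := h0.reg_length
    simp only [hS.reg_length, h11, h13, List.length_singleton] at ht
    simp only [List.length_cons, List.length_nil]
    split_ifs at ht <;> omega
  · simp only [Test.Holds, hS.reg_length] at hb
    rcases hcase with h | h
    · left; omega
    · right; exact h.2

/-! ### The linear-time program -/

/-- One round of the search: greedy construction from the label in register 6; if it is not
complete, continue after its labels on the first hull. Register 12 counts the labels seen. -/
def searchRound : Prog :=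
  .seq greedyFrom <| .seq (block [.add 12 12 11]) <|
    .ite (.eq 11 0) (block [.const 14 1]) (block [.copy 6 8])

/-- Setting up the tables of neighbours. -/
def setup : Prog :=
  -- Register 15 gets the address `n - 1` of the last label on the first hull, and register 18 that
  -- label; the second block does the same with `2 * n - 1`.
  .seq (block [.const 1 1, .add 2 0 0, .add 3 2 0, .add 4 3 0, .add 5 4 0, .copy 16 20, .copy 17 0,
    .sub 15 17 1, .load 18 15]) <| .seq (fillTables 2 3) <|
  .seq (block [.copy 16 0, .copy 17 2, .sub 15 17 1, .load 18 15]) <| .seq (fillTables 4 5) <|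
    block [.load 6 20]

/-- The program that finds compatible paths. -/
def solver : Prog :=
  .seq setup <| .seq (.loop (.lt 12 0) searchRound) <| block [.copy 0 14]

/-- What is known after some rounds of the search: either `m` labels are ruled out and the label in
register 6 comes next, or compatible paths are in memory. -/
def SearchState {n : ℕ} (p q : Fin n → Plane) (hP hQ : Equiv.Perm (Fin n)) (s : State) : Prop :=
  Tables hP hQ s ∧ s.reg 12 ≤ 2 * n ∧ ∃ x : Fin n, s.reg 6 = x ∧
    ((s.reg 14 = 0 ∧ ((∃ τ : List (Fin n), IsCompatible p q Set.univ τ) →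
        Sweep hP hQ (s.reg 12) x)) ∨
      (s.reg 14 = 1 ∧ n ≤ s.reg 12 ∧ ∃ τ : List (Fin n), IsCompatible p q Set.univ τ ∧
        ∀ (i : ℕ) (hi : i < τ.length), s.mem i = τ[i]))

/-- A round that explores `k ≥ 1` labels takes at most `20 * k + 20` steps, which the increase of
`60 * k` covers together with the test. -/
theorem runs_searchRound {n W : ℕ} {p q : Fin n → Plane} {hP hQ : Equiv.Perm (Fin n)}
    (HP : IsHullOrder p hP) (HQ : IsHullOrder q hQ) {s : State} (hW : 6 * n ≤ W)
    (H : SearchState p q hP hQ s) (hm : s.reg 12 < n) :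
    ∃ t s', Runs W searchRound s t s' ∧ SearchState p q hP hQ s' ∧ s.reg 12 < s'.reg 12 ∧
      t + 1 + 60 * s.reg 12 ≤ 60 * s'.reg 12 := by
  obtain ⟨hT, -, x, hx, hcase⟩ := H
  have hsweep := (hcase.resolve_right fun h => absurd h.2.1 (by omega))
  obtain ⟨t, s₁, l, a, b, c, d, hr, hS, ht, hl⟩ := halts_greedyFrom hW hT hx
  have hlen := length_le_of_nodup hS.nodup
  have hpos : 0 < l.length := List.length_pos_iff.2 fun e => by simpa [e] using hS.head
  have g11 := hS.reg_length
  have g12 := hS.reg_count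
  have g8 := hS.reg_b
  have g14 := hS.reg_result
  have g0 := hS.tables.reg_zero
  have hbn := b.2
  have key : Halts W (.seq (block [.add 12 12 11]) <|
      .ite (.eq 11 0) (block [.const 14 1]) (block [.copy 6 8])) s₁ 6 fun s' =>
      SearchState p q hP hQ s' ∧ s'.reg 12 = s.reg 12 + l.length := by
    refine (Halts.seq (T₁ := 2) (T₂ := 3) (R := (exec s₁ [.add 12 12 11] = ·))
      (halts_block ?_ rfl) ?_).mono (by omega) fun _ h => h
    · simp [Fits, Instr.value, g11, g12]
      omega
    · rintro _ rfl
      refine Halts.ite (T := 2) (fun h => ?_) (fun h => ?_)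
      · have hln : l.length = n := by
          simpa [Test.Holds, exec, Instr.result, g11, g0] using h
        refine halts_block ?_ ⟨⟨hS.tables.congr (fun r hr => ?_) fun _ _ => rfl, ?_, x, ?_,
          Or.inr ⟨?_, ?_, l, isCompatible_of_grows HP HQ hS.nodup hS.grows_left hS.grows_right
            hln.ge, hS.out⟩⟩, ?_⟩
        · simp [Fits, Instr.value]
          omega
        · have : r ≠ 12 ∧ r ≠ 14 := by omega
          simp [exec, Instr.result, this]
        · simp [exec, Instr.result, g11, g12]
          omega
        · simp [exec, Instr.result, hS.reg_start]
        · simp [exec, Instr.result]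
        · simp [exec, Instr.result, g11, g12]
          omega
        · simp [exec, Instr.result, g11, g12]
      · have hln : l.length ≠ n := by
          simpa [Test.Holds, exec, Instr.result, g11, g0] using h
        have hdead := hl.resolve_left hln
        refine halts_block ?_ ⟨⟨hS.tables.congr (fun r hr => ?_) fun _ _ => rfl, ?_, b, ?_,
          Or.inl ⟨?_, fun hex => ?_⟩⟩, ?_⟩
        · simp [Fits, Instr.value, exec, Instr.result, g8]
          omega
        · have : r ≠ 12 ∧ r ≠ 6 := by omega
          simp [exec, Instr.result, this]
        · simp [exec, Instr.result, g11, g12]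
          omega
        · simp [exec, Instr.result, g8]
        · simp [exec, Instr.result, g14, hsweep.1]
        · have := (hsweep.2 hex).step HP HQ hex hm ⟨hS.nodup, hS.grows_left, hS.grows_right,
            hdead.2, hdead.1⟩ hS.head hS.ends_left
          simpa [exec, Instr.result, g11, g12] using this
        · simp [exec, Instr.result, g11, g12]
  obtain ⟨t', s', ht', hr', hI, h12⟩ := key
  exact ⟨_, s', .seq _ _ _ _ _ _ _ hr hr', hI, by omega, by omega⟩

theorem pos_of_pos_next_eq_zero {n : ℕ} {h : Equiv.Perm (Fin n)} {y : Fin n}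
    (hy : pos h (next h y) = 0) : pos h y = n - 1 := by
  have := pos_next h y
  split_ifs at this <;> omega

theorem halts_setup {n W : ℕ} (p q : Fin n → Plane) (hP hQ : Equiv.Perm (Fin n)) (hn : 1 ≤ n)
    (hW : 6 * n ≤ W) :
    Halts W setup (inputState hP hQ) (19 * n + 22) fun s =>
      SearchState p q hP hQ s ∧ s.reg 12 = 0 := by
  have memP : ∀ i : Fin n, (inputState hP hQ).mem i = hP i := fun i => by simp [inputState]
  have memQ : ∀ i : Fin n, (inputState hP hQ).mem (n + i) = hQ i := fun i => by simp [inputState]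
  have lastP : (inputState hP hQ).mem (n - 1) = hP ⟨n - 1, by omega⟩ := memP ⟨n - 1, by omega⟩
  have lastQ : (inputState hP hQ).mem (2 * n - 1) = hQ ⟨n - 1, by omega⟩ := by
    rw [← memQ ⟨n - 1, by omega⟩]
    congr 1
    simp only
    omega
  have hlast : ∀ (h : Equiv.Perm (Fin n)) (y : Fin n), pos h (next h y) = 0 →
      (h ⟨n - 1, by omega⟩ : ℕ) = y := by
    intro h y hy
    have e : h.symm y = ⟨n - 1, by omega⟩ := Fin.ext (pos_of_pos_next_eq_zero hy)
    rw [← e, Equiv.apply_symm_apply]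
  have hPn := (hP ⟨n - 1, by omega⟩).2
  have hQn := (hQ ⟨n - 1, by omega⟩).2
  have r0 : (inputState hP hQ).reg 0 = n := by simp [inputState]
  have rr : ∀ r, r ≠ 0 → (inputState hP hQ).reg r = 0 := fun r hr => by simp [inputState, hr]
  set s₀ := inputState hP hQ with hs₀
  let i₁ : List Instr := [.const 1 1, .add 2 0 0, .add 3 2 0, .add 4 3 0, .add 5 4 0, .copy 16 20,
    .copy 17 0, .sub 15 17 1, .load 18 15]
  let i₂ : List Instr := [.copy 16 0, .copy 17 2, .sub 15 17 1, .load 18 15]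
  have two : n + n = 2 * n := by omega
  have three : 2 * n + n = 3 * n := by omega
  have four : 3 * n + n = 4 * n := by omega
  have five : 4 * n + n = 5 * n := by omega
  refine (Halts.seq (T₁ := 10) (T₂ := 18 * n + 9)
    (R := (exec s₀ i₁ = ·)) (halts_block ?_ rfl) ?_).mono (by omega) fun _ h => h
  · simp [Fits, Instr.value, Instr.result, r0, rr, two, three, four, five, lastP]
    omega
  rintro _ rfl
  refine (Halts.seq (T₂ := 9 * n + 8) (halts_fillTables (n := n) (st := 0) (dn := 2 * n) hP _
    (by omega) (by omega) ?_ ?_ ?_ ?_ ?_ (by omega) ?_ ?_ (by omega)) ?_).mono (by omega)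
    fun _ h => h
  · simp [i₁, exec, Instr.result]
  · simp [i₁, exec, Instr.result, r0, two]
  · simp [i₁, exec, Instr.result, r0, two]
  · simp [i₁, exec, Instr.result, rr]
  · simp [i₁, exec, Instr.result, r0]
  · simpa [i₁, exec, Instr.result] using memP
  · intro y hy
    simpa [i₁, exec, Instr.result, r0, lastP] using hlast hP y hy
  rintro s₁ ⟨hreg₁, htab₁, hmem₁⟩
  have a0 : s₁.reg 0 = n := by
    rw [hreg₁ 0 (by omega)]
    simp [i₁, exec, Instr.result, r0]
  have a1 : s₁.reg 1 = 1 := by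
    rw [hreg₁ 1 (by omega)]
    simp [i₁, exec, Instr.result]
  have a2 : s₁.reg 2 = 2 * n := by
    rw [hreg₁ 2 (by omega)]
    simp [i₁, exec, Instr.result, r0, two]
  have a3 : s₁.reg 3 = 3 * n := by
    rw [hreg₁ 3 (by omega)]
    simp [i₁, exec, Instr.result, r0, two, three]
  have a4 : s₁.reg 4 = 4 * n := by
    rw [hreg₁ 4 (by omega)]
    simp [i₁, exec, Instr.result, r0, two, three, four]
  have a5 : s₁.reg 5 = 5 * n := by
    rw [hreg₁ 5 (by omega)]
    simp [i₁, exec, Instr.result, r0, two, three, four, five]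
  have a12 : s₁.reg 12 = 0 := by
    rw [hreg₁ 12 (by omega)]
    simp [i₁, exec, Instr.result, rr]
  have a14 : s₁.reg 14 = 0 := by
    rw [hreg₁ 14 (by omega)]
    simp [i₁, exec, Instr.result, rr]
  have a20 : s₁.reg 20 = 0 := by
    rw [hreg₁ 20 (by omega)]
    simp [i₁, exec, Instr.result, rr]
  have m₁ : ∀ a, a < 2 * n → s₁.mem a = s₀.mem a := by
    intro a ha
    rw [hmem₁ a (by omega)]
    simp [i₁, exec, Instr.result]
  have lastQ₁ := (m₁ (2 * n - 1) (by omega)).trans lastQ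
  refine (Halts.seq (T₁ := 5) (T₂ := 9 * n + 3)
    (R := (exec s₁ i₂ = ·)) (halts_block ?_ rfl) ?_).mono (by omega) fun _ h => h
  · simp [Fits, Instr.value, Instr.result, a0, a1, a2, lastQ₁]
    omega
  rintro _ rfl
  refine (Halts.seq (T₂ := 2) (halts_fillTables (n := n) (st := n) (dn := 4 * n) hQ _
    (by omega) (by omega) ?_ ?_ ?_ ?_ ?_ (by omega) ?_ ?_ (by omega)) ?_).mono (by omega)
    fun _ h => h
  · simp [i₂, exec, Instr.result, a1]
  · simp [i₂, exec, Instr.result, a4]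
  · simp [i₂, exec, Instr.result, a5, five]
  · simp [i₂, exec, Instr.result, a0]
  · simp [i₂, exec, Instr.result, a2, two]
  · intro i
    rw [← memQ i, ← m₁ _ (by omega)]
    simp [i₂, exec, Instr.result]
  · intro y hy
    simpa [i₂, exec, Instr.result, a1, a2, lastQ₁] using hlast hQ y hy
  rintro s₂ ⟨hreg₂, htab₂, hmem₂⟩
  have hreg : ∀ r, r < 15 ∨ 19 < r → s₂.reg r = s₁.reg r := by
    intro r hr
    rw [hreg₂ r hr]
    have : r ≠ 16 ∧ r ≠ 17 ∧ r ≠ 15 ∧ r ≠ 18 := by omega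
    simp [i₂, exec, Instr.result, this]
  have m₂ : ∀ a, a < 4 * n → s₂.mem a = s₁.mem a := by
    intro a ha
    rw [hmem₂ a (by omega)]
    simp [i₂, exec, Instr.result]
  have hmem0 : s₂.mem 0 = hP ⟨0, by omega⟩ := by
    rw [m₂ 0 (by omega), m₁ 0 (by omega)]
    exact memP ⟨0, by omega⟩
  have hPn0 := (hP ⟨0, by omega⟩).2
  have c20 : s₂.reg 20 = 0 := by rw [hreg 20 (by omega), a20]
  have c12 : s₂.reg 12 = 0 := by rw [hreg 12 (by omega), a12]
  have htab : Tables hP hQ s₂ := by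
    refine ⟨?_, ?_, ?_, ?_, ?_, ?_, c20, fun y => ?_, fun y => ?_, fun y => ?_, fun y => ?_⟩
    · rw [hreg 0 (by omega), a0]
    · rw [hreg 1 (by omega), a1]
    · rw [hreg 2 (by omega), a2]
    · rw [hreg 3 (by omega), a3]
    · rw [hreg 4 (by omega), a4]
    · rw [hreg 5 (by omega), a5]
    · rw [m₂ _ (by omega)]
      exact (htab₁ y).1
    · have := (htab₁ ((nextPerm hP).symm y)).2
      rw [← nextPerm_apply, Equiv.apply_symm_apply, three] at this
      rw [m₂ _ (by omega), this]
    · exact (htab₂ y).1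
    · have := (htab₂ ((nextPerm hQ).symm y)).2
      rwa [← nextPerm_apply, Equiv.apply_symm_apply, five] at this
  refine (halts_block (is := [.load 6 20]) ?_ ⟨⟨htab.congr (fun r hr => ?_) fun _ _ => rfl, ?_,
    hP ⟨0, by omega⟩, ?_, Or.inl ⟨?_, fun _ => ?_⟩⟩, ?_⟩)
  · simp [Fits, Instr.value, c20, hmem0]
    omega
  · have : r ≠ 6 := by omega
    simp [exec, Instr.result, this]
  · simp [exec, Instr.result, c12]
  · simp [exec, Instr.result, c20, hmem0]
  · simp [exec, Instr.result, hreg, a14]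
  · simpa [exec, Instr.result, c12] using sweep_zero hP hQ _
  · simp [exec, Instr.result, c12]

/-- The count ends at no more than `2 * n`, so the search loop takes at most `120 * n + 1` steps;
with `19 * n + 22` for the tables and `2` at the end this is below `200 * n`. -/
theorem solver_correct {n : ℕ} (hn : 1 ≤ n) {p q : Fin n → Plane} {hP hQ : Equiv.Perm (Fin n)}
    (HP : IsHullOrder p hP) (HQ : IsHullOrder q hQ) :
    ∃ (t : ℕ) (s : State), t ≤ 200 * n ∧ Runs (200 * n) solver (inputState hP hQ) t s ∧
      ((∃ τ : List (Fin n), IsCompatible p q Set.univ τ ∧ AnswersWith s τ) ∨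
        ((¬ ∃ τ : List (Fin n), IsCompatible p q Set.univ τ) ∧ AnswersNone s)) := by
  have hW : 6 * n ≤ 200 * n := by omega
  obtain ⟨t₁, s₁, ht₁, hr₁, hI₁, h12⟩ := halts_setup p q hP hQ hn hW
  obtain ⟨t₂, s₂, hr₂, ⟨hI₂, hle⟩, hb, ht₂⟩ := Halts.loop (W := 200 * n) (b := .lt 12 0)
    (c := searchRound) (I := fun s => SearchState p q hP hQ s ∧ s.reg 12 ≤ 2 * n)
    (fun s => 2 * n - s.reg 12) (fun s => 60 * s.reg 12) (by
      rintro s ⟨hI, -⟩ hb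
      have hm : s.reg 12 < n := by
        rw [← hI.1.reg_zero]
        exact hb
      obtain ⟨t, s', hr, hI', h1, h2⟩ := runs_searchRound HP HQ hW hI hm
      exact ⟨t, s', hr, ⟨hI', hI'.2.1⟩, by omega, h2⟩) s₁ ⟨hI₁, by omega⟩
  obtain ⟨hT, -, x, -, hcase⟩ := hI₂
  have hm : n ≤ s₂.reg 12 := by
    simpa [Test.Holds, hT.reg_zero] using hb
  have hr₃ : Runs (200 * n) (block [.copy 0 14]) s₂ 2 (exec s₂ [.copy 0 14]) := by
    refine runs_block _ _ ?_
    rcases hcase with h | h <;> simp [Fits, Instr.value, h.1]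
    omega
  refine ⟨_, _, ?_, .seq _ _ _ _ _ _ _ hr₁ (.seq _ _ _ _ _ _ _ hr₂ hr₃), ?_⟩
  · omega
  · rcases hcase with ⟨h14, hs⟩ | ⟨h14, -, τ, hτ, hmem⟩
    · right
      refine ⟨Sweep.not_exists HP HQ hs hm, ?_⟩
      simp [AnswersNone, exec, Instr.result, h14]
    · left
      refine ⟨τ, hτ, ?_, hmem⟩
      simp [exec, Instr.result, h14]

end ConvexPaths

theorem mainTheorem3 :
    -- the linear-time algorithm
    (∃ (prog : Prog) (C : ℕ), ∀ (n : ℕ), 1 ≤ n →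
      ∀ (p q : Fin n → Plane) (hP hQ : Equiv.Perm (Fin n)),
        ConvexIndependent ℝ p → ConvexIndependent ℝ q → IsHullOrder p hP → IsHullOrder q hQ →
        ∃ (t : ℕ) (s : State), t ≤ C * n ∧ Runs (C * n) prog (inputState hP hQ) t s ∧
          ((∃ τ : List (Fin n), IsCompatible p q Set.univ τ ∧ AnswersWith s τ) ∨
            ((¬ ∃ τ : List (Fin n), IsCompatible p q Set.univ τ) ∧ AnswersNone s))) ∧
    -- the greedy construction
    (∀ (n : ℕ) (p q : Fin n → Plane) (hP hQ : Equiv.Perm (Fin n)),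
      ConvexIndependent ℝ p → ConvexIndependent ℝ q → IsHullOrder p hP → IsHullOrder q hQ →
      ∀ x : Fin n,
        (∃ σ : List (Fin n), IsGreedy hP hQ x σ) ∧
        ∀ σ : List (Fin n), IsGreedy hP hQ x σ →
          -- full length means compatible paths from `x`, and `σ` gives them
          (HasCompatibleFrom p q Set.univ x ↔ σ.length = n) ∧
          (σ.length = n → IsCompatible p q Set.univ σ) ∧
          -- a shorter sequence rules out all of its labels
          (σ.length < n → ∀ y ∈ σ, ¬ HasCompatibleFrom p q Set.univ y) ∧
          -- a shorter sequence occupies equally ordered intervals, or there are no compatible paths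
          (σ.length < n → (∃ τ : List (Fin n), IsCompatible p q Set.univ τ) →
            ∃ L : List (Fin n), L.Perm σ ∧ IsInterval hP L ∧ IsInterval hQ L) ∧
          -- the interior labels of these intervals can be deleted
          (σ.length < n → ∀ L : List (Fin n), L.Perm σ → IsInterval hP L → IsInterval hQ L →
            ∀ z : Fin n, z ∉ L.tail.dropLast →
              (HasCompatibleFrom p q Set.univ z ↔
                HasCompatibleFrom p q {y | y ∉ L.tail.dropLast} z))) :=
  ⟨⟨solver, 200, fun _ hn _ _ _ _ _ _ HP HQ => solver_correct hn HP HQ⟩,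
    fun _ _ _ hP hQ _ _ HP HQ x => ⟨exists_isGreedy hP hQ x, fun _ hσ =>
      greedy_construction HP HQ hσ⟩⟩
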